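/- Let $E$ be a complex Banach space and let $L$ be a finite-dimensional complex solvable Lie algebra acting on $E$ on the right by bounded operators: every $x\in L$ gives a bounded operator $e\mapsto e\,x$ on $E$, depending linearly on $x$, such that $e[x,y]=(e\,x)y-(e\,y)x$ for all $e\in E$ and $x,y\in L$ (for example, $L$ is a Lie algebra of bounded operators on $E$, written on the right of their argument). For a linear form $f\in L^*$ with $f([L,L])=0$, let $(E\otimes\wedge L,d(f))$ be the complex with maps $d_p(f):E\otimes\wedge^pL\to E\otimes\wedge^{p-1}L$ given for $p\ge 1$ by $$d_p(f)\,(e\otimes x_1\wedge\dots\wedge x_p)=\sum_{i=1}^{p}(-1)^{i+1}\,(e\,x_i-f(x_i)e)\otimes x_1\wedge\dots\wedge\widehat{x_i}\wedge\dots\wedge x_p+\sum_{1\le i<j\le p}(-1)^{i+j}\,e\otimes[x_i,x_j]\wedge x_1\wedge\dots\wedge\widehat{x_i}\wedge\dots\wedge\widehat{x_j}\wedge\dots\wedge x_p ,$$ and $d_0(f)=0$. For $p\ge 0$ put $$\Sigma_p(L,E)=\{f\in L^*: f([L,L])=0,\ \operatorname{Ran} d_{p+1}(f)\neq\operatorname{Ker}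 d_p(f)\},$$ and for an integer $k\ge 0$ put $\sigma_{\delta,k}(L,E)=\bigcup_{0\le p\le k}\Sigma_p(L,E)$ (the extended Słodkowski spectrum). Theorem 4.7 (projection property). Let $I$ be an ideal of $L$, acting on $E$ by restriction of the action of $L$, and let $\Pi:L^*\to I^*$, $\Pi(f)=f|_I$, be the restriction map. Then, for every integer $k\ge 0$, $$\sigma_{\delta,k}(I,E)=\Pi\bigl(\sigma_{\delta,k}(L,E)\bigr).$$ -/

import Mathlib

open scoped TensorProduct

noncomputable section

namespace SolvableSpectrum

section Exterior

variable (L : Type*) [LieRing L] [LieAlgebra ℂ L]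

/-- The linear map `⋀^(p+1) L → L ⊗ ⋀^p L`,
`x_0 ∧ … ∧ x_p ↦ ∑ i, (-1)^i x_i ⊗ (x_0 ∧ … ∧ x̂_i ∧ … ∧ x_p)`. -/
def removeOne (p : ℕ) : ⋀[ℂ]^(p + 1) L →ₗ[ℂ] L ⊗[ℂ] ⋀[ℂ]^p L :=
  exteriorPower.alternatingMapLinearEquiv
    (AlternatingMap.alternatizeUncurryFin
      (exteriorPower.alternatingMapLinearEquiv.symm.toLinearMap ∘ₗ
        TensorProduct.mk ℂ L (⋀[ℂ]^p L)))

/-- The bilinear map `(x, y) ↦ ((z_1, …, z_m) ↦ [x, y] ∧ z_1 ∧ … ∧ z_m)`. -/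
def bracketWedge (m : ℕ) : L →ₗ[ℂ] L →ₗ[ℂ] L [⋀^Fin m]→ₗ[ℂ] ⋀[ℂ]^(m + 1) L :=
  LinearMap.compr₂ (LieModule.toEnd ℂ L L : L →ₗ[ℂ] Module.End ℂ L)
    (AlternatingMap.curryLeft (exteriorPower.ιMulti ℂ (m + 1)))

/-- The bracket part `⋀^(p+1) L → ⋀^p L` of the boundary: the sum over all pairs `i < j` of
`± [x_i, x_j] ∧ (the other x's)`, obtained as half of the sum over all ordered pairs;
see `bracketPart_apply` for the explicit formula. -/
def bracketPart : (p : ℕ) → ⋀[ℂ]^(p + 1) L →ₗ[ℂ] ⋀[ℂ]^p L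
  | 0 => 0
  | m + 1 => exteriorPower.alternatingMapLinearEquiv
      ((-(1 / 2 : ℂ)) • AlternatingMap.alternatizeUncurryFin
        (AlternatingMap.alternatizeUncurryFinLM ∘ₗ bracketWedge L m))

variable {L}

theorem removeOne_apply (p : ℕ) (x : Fin (p + 1) → L) :
    removeOne L p (exteriorPower.ιMulti ℂ (p + 1) x) =
      ∑ i : Fin (p + 1), (-1 : ℤ) ^ (i : ℕ) •
        (x i ⊗ₜ[ℂ] exteriorPower.ιMulti ℂ p (i.removeNth x)) := by
  simp [removeOne, AlternatingMap.alternatizeUncurryFin_apply]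

/-- A pair `k < l` of positions in `{1, …, m + 2}` is `(k, l) = (i + 1, j + 2)` with
`0 ≤ i ≤ j ≤ m`, so that `(-1)^(k + l) = (-1)^(i + j + 1)`. -/
theorem bracketPart_apply (m : ℕ) (x : Fin (m + 2) → L) :
    bracketPart L (m + 1) (exteriorPower.ιMulti ℂ (m + 2) x) =
      ∑ i : Fin (m + 1), ∑ j ≥ i, (-1 : ℤ) ^ (i + j + 1 : ℕ) •
        exteriorPower.ιMulti ℂ (m + 1)
          (Matrix.vecCons ⁅x i.castSucc, x j.succ⁆ (j.removeNth (i.castSucc.removeNth x))) := by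
  have h (a b : L) (z : Fin m → L) : exteriorPower.ιMulti ℂ (m + 1) (Matrix.vecCons ⁅b, a⁆ z) =
      - exteriorPower.ιMulti ℂ (m + 1) (Matrix.vecCons ⁅a, b⁆ z) := by
    have := congrArg (fun g => g z) (map_neg (AlternatingMap.curryLeft
      (exteriorPower.ιMulti ℂ (M := L) (m + 1))) ⁅a, b⁆)
    rw [lie_skew] at this
    simpa only [AlternatingMap.curryLeft_apply_apply, AlternatingMap.neg_apply] using this
  simp only [bracketPart, exteriorPower.alternatingMapLinearEquiv_apply_ιMulti,
    AlternatingMap.smul_apply,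
    AlternatingMap.alternatizeUncurryFin_alternatizeUncurryFinLM_comp_apply, Finset.smul_sum]
  refine Finset.sum_congr rfl fun i _ => Finset.sum_congr rfl fun j _ => ?_
  simp only [bracketWedge, LinearMap.compr₂_apply, LieHom.coe_toLinearMap,
    LieModule.toEnd_apply_apply, AlternatingMap.curryLeft_apply_apply]
  rw [h (x i.castSucc) (x j.succ), sub_neg_eq_add, ← two_smul ℂ, smul_comm, smul_smul, pow_succ]
  norm_num

end Exterior

section Complex

variable {L : Type*} [LieRing L] [LieAlgebra ℂ L]
  {E : Type*} [NormedAddCommGroup E] [NormedSpace ℂ E]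

/-- Given a linear map `ρ` from `L` to the bounded operators on `E`, write `e x = ρ x e`. (It is a
right action of the Lie algebra `L` when `e [x, y] = (e x) y - (e y) x`.)
This is the bilinear map `(e, x) ↦ e (x - f x) = e x - f x • e`. -/
def shiftedAction (ρ : L →ₗ[ℂ] E →L[ℂ] E) (f : Module.Dual ℂ L) : E →ₗ[ℂ] L →ₗ[ℂ] E :=
  LinearMap.mk₂ ℂ (fun e x => ρ x e - f x • e)
    (fun e e' x => by simp only [map_add, smul_add]; abel)
    (fun c e x => by simp only [map_smul, smul_sub, smul_comm c])
    (fun e x y => by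
      simp only [map_add, _root_.add_apply, add_smul]; abel)
    (fun c e x => by
      simp only [map_smul, _root_.smul_apply, smul_sub,
        smul_eq_mul, mul_smul])

/-- The boundary `d_(p+1)(f) : E ⊗ ⋀^(p+1) L → E ⊗ ⋀^p L`; see `boundarySucc_apply_zero` and
`boundarySucc_apply_succ` for its values on elementary tensors. -/
def boundarySucc (ρ : L →ₗ[ℂ] E →L[ℂ] E) (f : Module.Dual ℂ L) (p : ℕ) :
    E ⊗[ℂ] ⋀[ℂ]^(p + 1) L →ₗ[ℂ] E ⊗[ℂ] ⋀[ℂ]^p L :=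
  (TensorProduct.lift (shiftedAction ρ f)).rTensor (⋀[ℂ]^p L) ∘ₗ
      (TensorProduct.assoc ℂ E L (⋀[ℂ]^p L)).symm.toLinearMap ∘ₗ
      (removeOne L p).lTensor E +
    (bracketPart L p).lTensor E

theorem boundarySucc_apply_zero (ρ : L →ₗ[ℂ] E →L[ℂ] E) (f : Module.Dual ℂ L)
    (e : E) (x : Fin 1 → L) :
    boundarySucc ρ f 0 (e ⊗ₜ[ℂ] exteriorPower.ιMulti ℂ 1 x) =
      (ρ (x 0) e - f (x 0) • e) ⊗ₜ[ℂ] exteriorPower.ιMulti ℂ 0 Fin.elim0 := by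
  simp only [boundarySucc, bracketPart, LinearMap.add_apply, LinearMap.comp_apply,
    LinearMap.lTensor_tmul, removeOne_apply]
  simp [shiftedAction, Subsingleton.elim (Fin.removeNth 0 x) Fin.elim0]

theorem boundarySucc_apply_succ (ρ : L →ₗ[ℂ] E →L[ℂ] E) (f : Module.Dual ℂ L) (m : ℕ)
    (e : E) (x : Fin (m + 2) → L) :
    boundarySucc ρ f (m + 1) (e ⊗ₜ[ℂ] exteriorPower.ιMulti ℂ (m + 2) x) =
      ∑ i : Fin (m + 2), (-1 : ℤ) ^ (i : ℕ) •
        ((ρ (x i) e - f (x i) • e) ⊗ₜ[ℂ] exteriorPower.ιMulti ℂ (m + 1) (i.removeNth x)) +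
      ∑ i : Fin (m + 1), ∑ j ≥ i, (-1 : ℤ) ^ (i + j + 1 : ℕ) •
        (e ⊗ₜ[ℂ] exteriorPower.ιMulti ℂ (m + 1)
          (Matrix.vecCons ⁅x i.castSucc, x j.succ⁆ (j.removeNth (i.castSucc.removeNth x)))) := by
  simp only [boundarySucc, LinearMap.add_apply, LinearMap.comp_apply, LinearMap.lTensor_tmul,
    removeOne_apply, bracketPart_apply, TensorProduct.tmul_sum, map_sum, TensorProduct.tmul_smul,
    map_zsmul]
  simp [shiftedAction]

/-- The boundary `d_p(f) : E ⊗ ⋀^p L → E ⊗ ⋀^(p-1) L` for all `p ≥ 0`, where `d_0(f) = 0`. -/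
def boundary (ρ : L →ₗ[ℂ] E →L[ℂ] E) (f : Module.Dual ℂ L) :
    (p : ℕ) → E ⊗[ℂ] ⋀[ℂ]^p L →ₗ[ℂ] E ⊗[ℂ] ⋀[ℂ]^(p - 1) L
  | 0 => 0
  | p + 1 => boundarySucc ρ f p

/-- `Σ_p(L, E)`: the linear forms `f` on `L` that vanish on `L² = [L, L]` and for which the complex
`(E ⊗ ⋀ L, d(f))` is not exact in degree `p`. -/
def sigmaDegree (ρ : L →ₗ[ℂ] E →L[ℂ] E) (p : ℕ) : Set (Module.Dual ℂ L) :=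
  {f | (∀ x y : L, f ⁅x, y⁆ = 0) ∧
    LinearMap.range (boundarySucc ρ f p) ≠ LinearMap.ker (boundary ρ f p)}

/-- The Słodkowski spectrum `σ_{δ,k}(L, E)`: the union of the `Σ_p(L, E)`, `0 ≤ p ≤ k`. -/
def slodkowskiDelta (ρ : L →ₗ[ℂ] E →L[ℂ] E) (k : ℕ) : Set (Module.Dual ℂ L) :=
  ⋃ p ≤ k, sigmaDegree ρ p

end Complex

end SolvableSpectrum

end

/-! Write `θ(y) = (y - f(y)) ⊗ 1 - 1 ⊗ ad y`, with `ad y` extended as a derivation of the exterior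
algebra. The boundary is determined by the homotopy formula `d(y ∧ u) = θ(y) u - y ∧ d u`
(`boundarySucc_wedge_succ`), and `d² = 0`, the commutation of `d` with `θ(y)` and functoriality all
follow from it by induction on the degree.

The heart of the matter is an ideal `K` of codimension one, `L = K ⊕ ℂ x`. Splitting chains as `a +
x ∧ b` exhibits the complex of `L` as the mapping cone of `θ(x)` on the complex of `K`, so that
`H_p(K) → H_p(K) → H_p(L) → H_{p-1}(K)` is exact, the first arrow being `θ(x)`. If `H_q(K) = 0` for
all `q ≤ p`, then `H_p(L) = 0`; hence restriction maps the spectrum of `L` into that of `K`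
(`Splitting.range_eq_ker`).

Conversely, let `f` lie in `Σ_p(K, E)`. The first point is that `f` kills `[L, K]`, so that it
extends to characters `f_c` of `L` with `f_c(x) = c`, one for each `c ∈ ℂ`. Indeed non-exactness
puts `f(v)` in the spectrum of an operator `s(v)` depending linearly on `v ∈ K`. A derivation `D =
ad y` of `K` with `y ∈ L` is induced by a bounded operator, so the operators `s(exp(tD) v)` are all
conjugate, and `t ↦ f(exp(tD) v)` is a bounded entire function, hence constant
(`apply_eq_zero_of_mem_spectrum`).

The second point is that the complex of `L` cannot be exact in degree `p` for every `f_c`: otherwise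
`A - c` would be surjective on `H_p(K)` for all `c`, where `A` is the unshifted action of `x`. An
operator on a nonzero Banach space does not have this property, by looking at a boundary point of
its spectrum. Since boundaries need not form a closed subspace, `H_p(K)` is not a Banach space;
passing to spaces of bounded sequences circumvents this (`surjective_of_forall_sub_smul_add`).

For a general proper ideal `I`, solvability of `L/I` gives a nonzero character of `L` vanishing on
`I`. Its kernel is an ideal of codimension one containing `I`, and induction on `dim L` concludes.
-/

open scoped TensorProduct

noncomputable section

namespace SolvableSpectrum

/-! ### Exterior multiplication by a vector -/

section Wedge

variable {M : Type*} [AddCommGroup M] [Module ℂ M]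

/-- Left exterior multiplication `⋀^p M → ⋀^(p+1) M` by a vector. -/
def wedge (p : ℕ) : M →ₗ[ℂ] ⋀[ℂ]^p M →ₗ[ℂ] ⋀[ℂ]^(p + 1) M :=
  exteriorPower.alternatingMapLinearEquiv.toLinearMap ∘ₗ
    AlternatingMap.curryLeft (exteriorPower.ιMulti ℂ (p + 1))

theorem wedge_apply_ιMulti (p : ℕ) (y : M) (z : Fin p → M) :
    wedge p y (exteriorPower.ιMulti ℂ p z) =
      exteriorPower.ιMulti ℂ (p + 1) (Matrix.vecCons y z) := by
  simp [wedge, AlternatingMap.curryLeft_apply_apply]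

theorem ιMulti_succ (p : ℕ) (z : Fin (p + 1) → M) :
    exteriorPower.ιMulti ℂ (p + 1) z =
      wedge p (z 0) (exteriorPower.ιMulti ℂ p (Fin.tail z)) := by
  rw [wedge_apply_ιMulti]
  congr 1
  exact (Fin.cons_self_tail z).symm

theorem hom_ext_ιMulti {N : Type*} [AddCommGroup N] [Module ℂ N] {p : ℕ}
    {φ ψ : ⋀[ℂ]^p M →ₗ[ℂ] N}
    (h : ∀ z, φ (exteriorPower.ιMulti ℂ p z) = ψ (exteriorPower.ιMulti ℂ p z)) : φ = ψ :=
  exteriorPower.linearMap_ext (AlternatingMap.ext h)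

/-- The products `y ∧ ω` span the next exterior power. This is what reduces identities about the
boundary to induction on the degree. -/
theorem hom_ext_wedge {N : Type*} [AddCommGroup N] [Module ℂ N] {p : ℕ}
    {φ ψ : ⋀[ℂ]^(p + 1) M →ₗ[ℂ] N}
    (h : ∀ y, φ ∘ₗ wedge p y = ψ ∘ₗ wedge p y) : φ = ψ :=
  hom_ext_ιMulti fun z => by
    rw [ιMulti_succ]
    exact LinearMap.congr_fun (h (z 0)) _

theorem wedge_self (p : ℕ) (y : M) (ω : ⋀[ℂ]^p M) : wedge (p + 1) y (wedge p y ω) = 0 := by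
  have : wedge (p + 1) y ∘ₗ wedge p y = 0 := hom_ext_ιMulti fun z => by
    simp only [LinearMap.comp_apply, wedge_apply_ιMulti, LinearMap.zero_apply]
    exact (exteriorPower.ιMulti ℂ (p + 2)).map_eq_zero_of_eq _ (i := 0) (j := 1) (by simp)
      (by simp)
  exact LinearMap.congr_fun this ω

theorem wedge_comm (p : ℕ) (y z : M) (ω : ⋀[ℂ]^p M) :
    wedge (p + 1) y (wedge p z ω) = -wedge (p + 1) z (wedge p y ω) := by
  have := wedge_self p (y + z) ω
  simp only [map_add, LinearMap.add_apply, wedge_self, zero_add, add_zero] at this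
  exact eq_neg_of_add_eq_zero_right this

theorem map_wedge {N : Type*} [AddCommGroup N] [Module ℂ N] (j : M →ₗ[ℂ] N) (p : ℕ) (y : M) :
    exteriorPower.map (p + 1) j ∘ₗ wedge p y = wedge p (j y) ∘ₗ exteriorPower.map p j :=
  hom_ext_ιMulti fun z => by
    simp only [LinearMap.comp_apply, wedge_apply_ιMulti, exteriorPower.map_apply_ιMulti]
    congr 1
    ext i
    refine Fin.cases ?_ (fun i => ?_) i <;> simp

end Wedge

/-! ### Derivations of the exterior algebra and recursions for the two parts of the boundary -/

section Derivation

variable {L : Type*} [LieRing L] [LieAlgebra ℂ L]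

theorem removeOne_wedge (p : ℕ) (y : L) (ω : ⋀[ℂ]^(p + 1) L) :
    removeOne L (p + 1) (wedge (p + 1) y ω) =
      y ⊗ₜ ω - (wedge p y).lTensor L (removeOne L p ω) := by
  have : removeOne L (p + 1) ∘ₗ wedge (p + 1) y =
      TensorProduct.mk ℂ L _ y - (wedge p y).lTensor L ∘ₗ removeOne L p :=
    hom_ext_ιMulti fun z => by
      simp only [LinearMap.comp_apply, wedge_apply_ιMulti, LinearMap.sub_apply,
        TensorProduct.mk_apply, removeOne_apply, map_sum, map_zsmul, LinearMap.lTensor_tmul]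
      rw [Fin.sum_univ_succ, sub_eq_add_neg, ← Finset.sum_neg_distrib]
      congr 1
      · simp
      · refine Finset.sum_congr rfl fun i _ => ?_
        simp only [Matrix.cons_val_succ, Fin.val_succ, pow_succ, mul_neg_one, neg_smul]
        congr 4
        ext k
        refine Fin.cases ?_ (fun k => ?_) k <;> simp [Fin.removeNth]
  exact LinearMap.congr_fun this ω

theorem removeOne_wedge_zero (y : L) (ω : ⋀[ℂ]^0 L) :
    removeOne L 0 (wedge 0 y ω) = y ⊗ₜ ω := by
  have : removeOne L 0 ∘ₗ wedge 0 y = TensorProduct.mk ℂ L _ y :=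
    hom_ext_ιMulti fun z => by
      simp only [LinearMap.comp_apply, wedge_apply_ιMulti,
        TensorProduct.mk_apply, removeOne_apply]
      simp
  exact LinearMap.congr_fun this ω

/-- The extension of a linear endomorphism `D` of `L` to a derivation of the exterior algebra,
in degree `p`. -/
def derivExt (D : Module.End ℂ L) : (p : ℕ) → Module.End ℂ (⋀[ℂ]^p L)
  | 0 => 0
  | p + 1 => TensorProduct.lift (wedge p) ∘ₗ D.rTensor (⋀[ℂ]^p L) ∘ₗ removeOne L p

theorem derivExt_wedge (D : Module.End ℂ L) (p : ℕ) (y : L) (ω : ⋀[ℂ]^p L) :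
    derivExt D (p + 1) (wedge p y ω) = wedge p (D y) ω + wedge p y (derivExt D p ω) := by
  cases p with
  | zero =>
    simp [derivExt, removeOne_wedge_zero]
  | succ p =>
    simp only [derivExt, LinearMap.comp_apply, removeOne_wedge]
    rw [map_sub, map_sub, LinearMap.rTensor_tmul, TensorProduct.lift.tmul, sub_eq_add_neg,
      add_right_inj]
    induction removeOne L p ω using TensorProduct.induction_on with
    | zero => simp
    | tmul a b => simp [wedge_comm p (D a) y]
    | add a b ha hb => simp only [map_add, neg_add, ha, hb]

theorem derivExt_commutator (D D' : Module.End ℂ L) (p : ℕ) :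
    derivExt (D * D' - D' * D) p =
      derivExt D p * derivExt D' p - derivExt D' p * derivExt D p := by
  induction p with
  | zero =>
    simp only [derivExt, mul_zero]
    exact (sub_zero (0 : Module.End ℂ (⋀[ℂ]^0 L))).symm
  | succ p ih =>
    refine hom_ext_wedge fun y => LinearMap.ext fun ω => ?_
    simp only [LinearMap.comp_apply, derivExt_wedge, ih, LinearMap.sub_apply, Module.End.mul_apply, map_add, map_sub]
    abel

theorem derivExt_map {K : Type*} [LieRing K] [LieAlgebra ℂ K] (j : K →ₗ[ℂ] L)
    (D : Module.End ℂ K) (D' : Module.End ℂ L) (h : j ∘ₗ D = D' ∘ₗ j) (p : ℕ) :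
    exteriorPower.map p j ∘ₗ derivExt D p = derivExt D' p ∘ₗ exteriorPower.map p j := by
  induction p with
  | zero => simp [derivExt]
  | succ p ih =>
    refine hom_ext_wedge fun y => LinearMap.ext fun ω => ?_
    have hw (y ω) := LinearMap.congr_fun (map_wedge j p y) ω
    have hy := LinearMap.congr_fun h y
    have hω := LinearMap.congr_fun ih ω
    simp only [LinearMap.comp_apply] at hw hy hω ⊢
    simp only [derivExt_wedge, map_add, hw, hy, hω]

/-- The pairs that contain the new first vector `y` add up to `-ad y` acting as a derivation; the
remaining pairs reproduce the old sum with `y` inside, and moving `y` in front of the bracket costs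
a sign. -/
theorem bracketPart_wedge (p : ℕ) (y : L) (ω : ⋀[ℂ]^(p + 1) L) :
    bracketPart L (p + 1) (wedge (p + 1) y ω) =
      -derivExt (LieAlgebra.ad ℂ L y) (p + 1) ω - wedge p y (bracketPart L p ω) := by
  have : bracketPart L (p + 1) ∘ₗ wedge (p + 1) y =
      -derivExt (LieAlgebra.ad ℂ L y) (p + 1) - wedge p y ∘ₗ bracketPart L p :=
    hom_ext_ιMulti fun z => by
      simp only [LinearMap.comp_apply, wedge_apply_ιMulti, LinearMap.sub_apply,
        LinearMap.neg_apply, derivExt, bracketPart_apply, removeOne_apply, map_sum, map_zsmul,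
        LinearMap.rTensor_tmul, TensorProduct.lift.tmul]
      rw [Fin.sum_univ_succ, sub_eq_add_neg]
      congr 1
      · rw [← Finset.sum_neg_distrib]
        refine Finset.sum_congr (by ext; simp) fun i _ => ?_
        simp only [Fin.val_zero, zero_add, pow_succ, mul_neg_one, neg_smul]
        rfl
      · cases p with
        | zero => simp [bracketPart]
        | succ p =>
          rw [bracketPart_apply, map_sum, ← Finset.sum_neg_distrib]
          refine Finset.sum_congr rfl fun i _ => ?_
          have hI : Finset.Ici i.succ = (Finset.Ici i).map (Fin.succEmb (p + 1)) := by
            ext k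
            refine Fin.cases ?_ (fun k => ?_) k <;> simp [Fin.succ_ne_zero]
          rw [hI, Finset.sum_map, map_sum, ← Finset.sum_neg_distrib]
          refine Finset.sum_congr rfl fun k _ => ?_
          simp only [Fin.coe_succEmb, map_zsmul, Fin.val_succ, wedge_apply_ιMulti]
          have hr : (k.succ.removeNth (i.succ.castSucc.removeNth (Matrix.vecCons y z))) =
              Matrix.vecCons y (k.removeNth (i.castSucc.removeNth z)) := by
            ext l
            refine Fin.cases ?_ (fun l => ?_) l <;>
              simp [Fin.removeNth]
          -- Both positions move up by one, so the sign `(-1)^(i + j + 1)` does not change; the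
          -- minus sign comes from exchanging `y` with the bracket.
          rw [hr, ← wedge_apply_ιMulti, ← wedge_apply_ιMulti, wedge_comm, wedge_apply_ιMulti,
            wedge_apply_ιMulti, ← Fin.succ_castSucc, Matrix.cons_val_succ, Matrix.cons_val_succ,
            show (i : ℕ) + 1 + (k + 1) + 1 = (i + k + 1) + 2 by ring, pow_add _ _ 2]
          simp
  exact LinearMap.congr_fun this ω

theorem bracketPart_wedge_zero (y : L) (ω : ⋀[ℂ]^0 L) :
    bracketPart L 0 (wedge 0 y ω) = 0 := rfl

end Derivation

/-! ### The homotopy formula and the identity `d² = 0` -/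

section Complex

variable {L : Type*} [LieRing L] [LieAlgebra ℂ L]
  {E : Type*} [NormedAddCommGroup E] [NormedSpace ℂ E]

theorem hom_ext_tensor_wedge {E M N : Type*} [AddCommGroup E] [Module ℂ E] [AddCommGroup M]
    [Module ℂ M] [AddCommGroup N] [Module ℂ N] {p : ℕ} {φ ψ : E ⊗[ℂ] ⋀[ℂ]^(p + 1) M →ₗ[ℂ] N}
    (h : ∀ y u, φ ((wedge p y).lTensor E u) = ψ ((wedge p y).lTensor E u)) : φ = ψ :=
  TensorProduct.ext <| LinearMap.ext fun e => hom_ext_wedge fun y => LinearMap.ext fun ω => by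
    simpa using h y (e ⊗ₜ ω)

/-- The operator `A ⊗ 1 - 1 ⊗ D` on `E ⊗ ⋀^p L`, where `D` is extended to `⋀^p L` as a
derivation. -/
def tensorAction (A : Module.End ℂ E) (D : Module.End ℂ L) (p : ℕ) :
    Module.End ℂ (E ⊗[ℂ] ⋀[ℂ]^p L) :=
  A.rTensor _ - (derivExt D p).lTensor E

theorem tensorAction_tmul (A : Module.End ℂ E) (D : Module.End ℂ L) (p : ℕ) (e : E)
    (ω : ⋀[ℂ]^p L) : tensorAction A D p (e ⊗ₜ ω) = A e ⊗ₜ ω - e ⊗ₜ derivExt D p ω := rfl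

theorem tensorAction_wedge (A : Module.End ℂ E) (D : Module.End ℂ L) (p : ℕ) (y : L)
    (u : E ⊗[ℂ] ⋀[ℂ]^p L) :
    tensorAction A D (p + 1) ((wedge p y).lTensor E u) =
      (wedge p y).lTensor E (tensorAction A D p u) - (wedge p (D y)).lTensor E u := by
  induction u using TensorProduct.induction_on with
  | zero => simp
  | tmul e ω =>
    simp only [tensorAction_tmul, LinearMap.lTensor_tmul, derivExt_wedge, map_sub,
      TensorProduct.tmul_add]
    abel
  | add u v hu hv => simp only [map_add, hu, hv]; abel

/-- The order is reversed on `E` because `L` acts there on the right, and the minus sign in `A ⊗ 1 -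
1 ⊗ D` compensates for it. -/
theorem tensorAction_commutator (A A' : Module.End ℂ E) (D D' : Module.End ℂ L) (p : ℕ) :
    tensorAction (A' * A - A * A') (D * D' - D' * D) p =
      tensorAction A' D' p * tensorAction A D p - tensorAction A D p * tensorAction A' D' p := by
  refine TensorProduct.ext' fun e ω => ?_
  simp only [tensorAction_tmul, derivExt_commutator, LinearMap.sub_apply, Module.End.mul_apply,
    map_sub, TensorProduct.sub_tmul, TensorProduct.tmul_sub]
  abel

/-- The operator `e ↦ e y - f y • e`. -/
def shift (ρ : L →ₗ[ℂ] E →L[ℂ] E) (f : Module.Dual ℂ L) (y : L) : Module.End ℂ E :=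
  (ρ y : E →ₗ[ℂ] E) - f y • 1

theorem shift_apply (ρ : L →ₗ[ℂ] E →L[ℂ] E) (f : Module.Dual ℂ L) (y : L) (e : E) :
    shift ρ f y e = ρ y e - f y • e := rfl

theorem boundarySucc_tmul (ρ : L →ₗ[ℂ] E →L[ℂ] E) (f : Module.Dual ℂ L) (p : ℕ) (e : E)
    (ω : ⋀[ℂ]^(p + 1) L) :
    boundarySucc ρ f p (e ⊗ₜ ω) =
      TensorProduct.lift ((TensorProduct.mk ℂ E _).compl₁₂ (shiftedAction ρ f e) .id)
        (removeOne L p ω) + e ⊗ₜ bracketPart L p ω := by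
  simp only [boundarySucc, LinearMap.add_apply, LinearMap.comp_apply, LinearMap.lTensor_tmul,
    add_left_inj]
  induction removeOne L p ω using TensorProduct.induction_on with
  | zero => simp
  | tmul a b => simp
  | add a b ha hb => simp only [TensorProduct.tmul_add, map_add, ha, hb]

theorem boundarySucc_wedge_zero (ρ : L →ₗ[ℂ] E →L[ℂ] E) (f : Module.Dual ℂ L) (y : L)
    (u : E ⊗[ℂ] ⋀[ℂ]^0 L) :
    boundarySucc ρ f 0 ((wedge 0 y).lTensor E u) =
      tensorAction (shift ρ f y) (LieAlgebra.ad ℂ L y) 0 u := by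
  induction u using TensorProduct.induction_on with
  | zero => simp
  | tmul e ω =>
    simp [boundarySucc_tmul, removeOne_wedge_zero, bracketPart_wedge_zero, tensorAction_tmul,
      derivExt, shift_apply, shiftedAction, TensorProduct.sub_tmul, TensorProduct.smul_tmul']
  | add u v hu hv => simp only [map_add, hu, hv]

/-- The homotopy formula `d(y ∧ u) = θ(y) u - y ∧ d u`, on which all later computations with the
boundary rest. -/
theorem boundarySucc_wedge_succ (ρ : L →ₗ[ℂ] E →L[ℂ] E) (f : Module.Dual ℂ L) (p : ℕ) (y : L)
    (u : E ⊗[ℂ] ⋀[ℂ]^(p + 1) L) :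
    boundarySucc ρ f (p + 1) ((wedge (p + 1) y).lTensor E u) =
      tensorAction (shift ρ f y) (LieAlgebra.ad ℂ L y) (p + 1) u -
        (wedge p y).lTensor E (boundarySucc ρ f p u) := by
  induction u using TensorProduct.induction_on with
  | zero => simp
  | tmul e ω =>
    have h (t : L ⊗[ℂ] ⋀[ℂ]^p L) :
        TensorProduct.lift ((TensorProduct.mk ℂ E _).compl₁₂ (shiftedAction ρ f e) .id)
          ((wedge p y).lTensor L t) = (wedge p y).lTensor E
        (TensorProduct.lift ((TensorProduct.mk ℂ E _).compl₁₂ (shiftedAction ρ f e) .id) t) := by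
      induction t using TensorProduct.induction_on with
      | zero => simp
      | tmul a b => simp
      | add a b ha hb => simp only [map_add, ha, hb]
    rw [LinearMap.lTensor_tmul, boundarySucc_tmul, boundarySucc_tmul, removeOne_wedge,
      bracketPart_wedge, map_sub, h, map_add, tensorAction_tmul, TensorProduct.tmul_sub,
      TensorProduct.tmul_neg, TensorProduct.lift.tmul, LinearMap.lTensor_tmul]
    simp only [LinearMap.compl₁₂_apply, LinearMap.id_apply, TensorProduct.mk_apply]
    rw [show shiftedAction ρ f e y = shift ρ f y e from rfl]
    abel
  | add u v hu hv => simp only [map_add, hu, hv]; abel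

/-- The operators `tensorAction A D` form an endomorphism of the complex. -/
theorem boundarySucc_tensorAction (ρ : L →ₗ[ℂ] E →L[ℂ] E) (f : Module.Dual ℂ L)
    (A : Module.End ℂ E) (D : Module.End ℂ L) (hD : ∀ y z, D ⁅y, z⁆ = ⁅D y, z⁆ + ⁅y, D z⁆)
    (hf : ∀ y, f (D y) = 0)
    (hA : ∀ y e, ρ (D y) e = ρ y (A e) - A (ρ y e)) (p : ℕ) (u : E ⊗[ℂ] ⋀[ℂ]^(p + 1) L) :
    boundarySucc ρ f p (tensorAction A D (p + 1) u) =
      tensorAction A D p (boundarySucc ρ f p u) := by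
  -- This is `θ(D y)` as the commutator of `θ(y)` with `tensorAction A D`. Scalar shifts drop out of
  -- a commutator, hence the need for `f (D y) = 0`.
  have key (y : L) (p : ℕ) (u : E ⊗[ℂ] ⋀[ℂ]^p L) :
      tensorAction (shift ρ f (D y)) (LieAlgebra.ad ℂ L (D y)) p u =
        tensorAction (shift ρ f y) (LieAlgebra.ad ℂ L y) p (tensorAction A D p u) -
        tensorAction A D p (tensorAction (shift ρ f y) (LieAlgebra.ad ℂ L y) p u) := by
    have := LinearMap.congr_fun (tensorAction_commutator A (shift ρ f y)
      D (LieAlgebra.ad ℂ L y) p) u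
    simp only [LinearMap.sub_apply, Module.End.mul_apply] at this
    rw [← this]
    congr 2
    · ext e
      simp only [shift_apply, LinearMap.sub_apply, Module.End.mul_apply, hf, hA, map_sub, map_smul]
      simp
    · ext z
      simp [hD]
  induction p with
  | zero =>
    refine LinearMap.congr_fun (f := boundarySucc ρ f 0 ∘ₗ tensorAction A D 1)
      (g := tensorAction A D 0 ∘ₗ boundarySucc ρ f 0) (hom_ext_tensor_wedge fun y u => ?_) u
    simp only [LinearMap.comp_apply]
    rw [tensorAction_wedge, map_sub, boundarySucc_wedge_zero, boundarySucc_wedge_zero,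
      boundarySucc_wedge_zero]
    rw [key]
    abel
  | succ p ih =>
    refine LinearMap.congr_fun (f := boundarySucc ρ f (p + 1) ∘ₗ tensorAction A D (p + 2))
      (g := tensorAction A D (p + 1) ∘ₗ boundarySucc ρ f (p + 1))
      (hom_ext_tensor_wedge fun y u => ?_) u
    simp only [LinearMap.comp_apply]
    rw [tensorAction_wedge, map_sub, boundarySucc_wedge_succ, boundarySucc_wedge_succ,
      boundarySucc_wedge_succ, map_sub, tensorAction_wedge, ih]
    rw [key]
    abel

/-- By the homotopy formula, `d d (y ∧ u) = d θ(y) u - θ(y) d u + y ∧ d d u`. The first two terms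
cancel because `θ(y)` commutes with `d`, and the last is zero by induction. -/
theorem boundarySucc_boundarySucc (ρ : L →ₗ[ℂ] E →L[ℂ] E)
    (hρ : ∀ (x y : L) (e : E), ρ ⁅x, y⁆ e = ρ y (ρ x e) - ρ x (ρ y e))
    (f : Module.Dual ℂ L) (hf : ∀ x y : L, f ⁅x, y⁆ = 0) (p : ℕ)
    (u : E ⊗[ℂ] ⋀[ℂ]^(p + 2) L) : boundarySucc ρ f p (boundarySucc ρ f (p + 1) u) = 0 := by
  have hS (y : L) (p : ℕ) (u : E ⊗[ℂ] ⋀[ℂ]^(p + 1) L) :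
      boundarySucc ρ f p (tensorAction (shift ρ f y) (LieAlgebra.ad ℂ L y) (p + 1) u) =
        tensorAction (shift ρ f y) (LieAlgebra.ad ℂ L y) p (boundarySucc ρ f p u) :=
    boundarySucc_tensorAction ρ f (shift ρ f y) (LieAlgebra.ad ℂ L y) (fun _ _ => by simp) (fun z => by simp [hf])
      (fun z e => by simp [shift_apply, hρ]) p u
  induction p with
  | zero =>
    refine LinearMap.congr_fun (f := boundarySucc ρ f 0 ∘ₗ boundarySucc ρ f 1)
      (g := 0) (hom_ext_tensor_wedge fun y u => ?_) u
    rw [LinearMap.comp_apply, boundarySucc_wedge_succ, map_sub, boundarySucc_wedge_zero, hS,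
      sub_self, LinearMap.zero_apply]
  | succ p ih =>
    refine LinearMap.congr_fun (f := boundarySucc ρ f (p + 1) ∘ₗ boundarySucc ρ f (p + 2))
      (g := 0) (hom_ext_tensor_wedge fun y u => ?_) u
    rw [LinearMap.comp_apply, boundarySucc_wedge_succ, map_sub, boundarySucc_wedge_succ, hS,
      ih, map_zero, sub_zero, sub_self, LinearMap.zero_apply]

end Complex

/-! ### Functoriality in the Lie algebra -/

section Functoriality

variable {K L : Type*} [LieRing K] [LieAlgebra ℂ K] [LieRing L] [LieAlgebra ℂ L]
  {E : Type*} [NormedAddCommGroup E] [NormedSpace ℂ E]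

/-- The map `E ⊗ ⋀^p K → E ⊗ ⋀^p L` induced by a linear map. -/
def tensorMap (E : Type*) [NormedAddCommGroup E] [NormedSpace ℂ E] (j : K →ₗ[ℂ] L) (p : ℕ) :
    E ⊗[ℂ] ⋀[ℂ]^p K →ₗ[ℂ] E ⊗[ℂ] ⋀[ℂ]^p L :=
  (exteriorPower.map p j).lTensor E

theorem tensorMap_wedge (j : K →ₗ[ℂ] L) (p : ℕ) (y : K) (u : E ⊗[ℂ] ⋀[ℂ]^p K) :
    tensorMap E j (p + 1) ((wedge p y).lTensor E u) =
      (wedge p (j y)).lTensor E (tensorMap E j p u) := by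
  rw [tensorMap, tensorMap, ← LinearMap.lTensor_comp_apply, map_wedge, LinearMap.lTensor_comp_apply]

theorem tensorMap_tensorAction (j : K →ₗ[ℂ] L) (A : Module.End ℂ E)
    (D : Module.End ℂ K) (D' : Module.End ℂ L) (h : j ∘ₗ D = D' ∘ₗ j) (p : ℕ)
    (u : E ⊗[ℂ] ⋀[ℂ]^p K) :
    tensorMap E j p (tensorAction A D p u) = tensorAction A D' p (tensorMap E j p u) := by
  have := fun ω => LinearMap.congr_fun (derivExt_map j D D' h p) ω
  induction u using TensorProduct.induction_on with
  | zero => simp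
  | tmul e ω =>
    simp only [LinearMap.comp_apply] at this
    simp only [tensorAction_tmul, tensorMap, map_sub, LinearMap.lTensor_tmul, this]
  | add u v hu hv => simp only [map_add, hu, hv]

theorem boundarySucc_tensorMap (ρ : L →ₗ[ℂ] E →L[ℂ] E) (f : Module.Dual ℂ L) (j : K →ₗ⁅ℂ⁆ L)
    (p : ℕ) (u : E ⊗[ℂ] ⋀[ℂ]^(p + 1) K) :
    boundarySucc ρ f p (tensorMap E (j : K →ₗ[ℂ] L) (p + 1) u) =
      tensorMap E (j : K →ₗ[ℂ] L) p
        (boundarySucc (ρ ∘ₗ (j : K →ₗ[ℂ] L)) (f ∘ₗ (j : K →ₗ[ℂ] L)) p u) := by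
  have hj (y : K) : (j : K →ₗ[ℂ] L) ∘ₗ LieAlgebra.ad ℂ K y =
      LieAlgebra.ad ℂ L (j y) ∘ₗ (j : K →ₗ[ℂ] L) := by
    ext z; simp
  have hS (y : K) : shift (ρ ∘ₗ (j : K →ₗ[ℂ] L)) (f ∘ₗ (j : K →ₗ[ℂ] L)) y = shift ρ f (j y) := rfl
  induction p with
  | zero =>
    refine LinearMap.congr_fun (f := boundarySucc ρ f 0 ∘ₗ tensorMap E (j : K →ₗ[ℂ] L) 1)
      (g := tensorMap E (j : K →ₗ[ℂ] L) 0 ∘ₗ boundarySucc _ _ 0)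
      (hom_ext_tensor_wedge fun y u => ?_) u
    simp only [LinearMap.comp_apply]
    rw [tensorMap_wedge, boundarySucc_wedge_zero, boundarySucc_wedge_zero, hS,
      tensorMap_tensorAction _ _ _ _ (hj y)]
    rfl
  | succ p ih =>
    refine LinearMap.congr_fun
      (f := boundarySucc ρ f (p + 1) ∘ₗ tensorMap E (j : K →ₗ[ℂ] L) (p + 2))
      (g := tensorMap E (j : K →ₗ[ℂ] L) (p + 1) ∘ₗ boundarySucc _ _ (p + 1))
      (hom_ext_tensor_wedge fun y u => ?_) u
    simp only [LinearMap.comp_apply]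
    rw [tensorMap_wedge, boundarySucc_wedge_succ, boundarySucc_wedge_succ, ih, map_sub, hS,
      tensorMap_wedge, tensorMap_tensorAction _ _ _ _ (hj y)]
    rfl

end Functoriality

/-! ### Banach space arguments: surjectivity on cokernels, and invariance of spectral linear forms
-/

section Banach

open BoundedContinuousFunction Filter Topology

/-- On a nonzero complex Banach space, `T - λ` cannot be surjective for all `λ`. -/
theorem subsingleton_of_forall_surjective {Q : Type*} [NormedAddCommGroup Q] [NormedSpace ℂ Q]
    [CompleteSpace Q] (T : Q →L[ℂ] Q)
    (h : ∀ c : ℂ, Function.Surjective (T - c • ContinuousLinearMap.id ℂ Q)) :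
    Subsingleton Q := by
  by_contra hQ
  rw [not_subsingleton_iff_nontrivial] at hQ
  have hne : (spectrum ℂ T).Nonempty := spectrum.nonempty T
  have huniv : spectrum ℂ T ≠ Set.univ := fun hu =>
    NormedSpace.unbounded_univ ℂ ℂ (hu ▸ spectrum.isBounded T)
  -- At a boundary point `c` of the spectrum, surjectivity of `T - c` bounds the resolvent at nearby
  -- points, which will make `T - c` injective as well.
  obtain ⟨c, hc⟩ := nonempty_frontier_iff.2 ⟨hne, huniv⟩
  have hcσ : c ∈ spectrum ℂ T := (spectrum.isClosed T).frontier_subset hc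
  rw [frontier_eq_closure_inter_closure] at hc
  obtain ⟨C, hC, hpre⟩ := (T - c • ContinuousLinearMap.id ℂ Q).exists_preimage_norm_le (h c)
  obtain ⟨d, hd, hcd⟩ := Metric.mem_closure_iff.1 hc.2 (1 / (4 * C)) (by positivity)
  have hsmall : ‖c - d‖ * C ≤ 1 / 4 := by
    rw [dist_eq_norm] at hcd
    calc ‖c - d‖ * C ≤ 1 / (4 * C) * C := by gcongr
      _ = 1 / 4 := by field_simp
  have hunit : IsUnit (algebraMap ℂ (Q →L[ℂ] Q) d - T) := spectrum.notMem_iff.1 hd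
  have halg (a : ℂ) (q : Q) : (algebraMap ℂ (Q →L[ℂ] Q) a - T) q = a • q - T q := by
    simp [Algebra.algebraMap_eq_smul_one]
  -- the inverse of `d - T` is bounded by `2 C`
  have hinv (q : Q) : ‖q‖ ≤ 2 * C * ‖d • q - T q‖ := by
    obtain ⟨S, hS⟩ := hunit
    have hRl : ∀ q, (↑S⁻¹ : Q →L[ℂ] Q) (d • q - T q) = q := fun q => by
      rw [← halg, ← hS]
      exact DFunLike.congr_fun S.inv_mul q
    set R : Q →L[ℂ] Q := ↑S⁻¹
    -- Lifting `y` through `T - c` to `q` with `‖q‖ ≤ C ‖y‖` gives `R y = -(q + (c - d) R q)`. The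
    -- term in `‖R‖` on the right is absorbed since `‖c - d‖ C ≤ 1/4`.
    have hR : ‖R‖ ≤ C + ‖c - d‖ * C * ‖R‖ := by
      refine R.opNorm_le_bound (by positivity) fun y => ?_
      obtain ⟨q, hq, hqy⟩ := hpre y
      have hy : y = -(d • q - T q) - (c - d) • q := by
        rw [← hq]
        simp only [_root_.sub_apply, _root_.smul_apply, ContinuousLinearMap.id_apply,
          sub_smul]
        abel
      calc ‖R y‖ = ‖q + (c - d) • R q‖ := by
            conv_lhs => rw [hy]
            rw [map_sub, map_neg, hRl, map_smul, ← norm_neg]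
            congr 1; abel
        _ ≤ ‖q‖ + ‖c - d‖ * (‖R‖ * ‖q‖) := by
            refine (norm_add_le _ _).trans ?_
            rw [norm_smul]
            gcongr
            exact R.le_opNorm q
        _ = (1 + ‖c - d‖ * ‖R‖) * ‖q‖ := by ring
        _ ≤ (1 + ‖c - d‖ * ‖R‖) * (C * ‖y‖) := by gcongr
        _ = _ := by ring
    have hR2 : ‖R‖ ≤ 2 * C := by nlinarith [norm_nonneg R]
    calc ‖q‖ = ‖R (d • q - T q)‖ := by rw [hRl]
      _ ≤ _ := (R.le_opNorm _).trans (by gcongr)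
  have hinj : Function.Injective (algebraMap ℂ (Q →L[ℂ] Q) c - T) := by
    refine (injective_iff_map_eq_zero _).2 fun q hq => ?_
    rw [halg] at hq
    have h1 := hinv q
    rw [show d • q - T q = (d - c) • q by rw [sub_smul, sub_eq_zero.1 hq], norm_smul,
      norm_sub_rev] at h1
    have : ‖q‖ ≤ 0 := by nlinarith [norm_nonneg q]
    simpa using this
  refine hcσ (ContinuousLinearMap.isUnit_iff_bijective.2 ⟨hinj, fun y => ?_⟩)
  obtain ⟨q, hq⟩ := h c (-y)
  refine ⟨q, ?_⟩
  rw [halg, ← neg_neg y, ← hq]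
  simp

/-- A bounded operator whose image of some ball approximates the unit ball up to `1 / 2` is
surjective. -/
theorem surjective_of_approx {X N : Type*} [NormedAddCommGroup X] [NormedSpace ℂ X]
    [CompleteSpace X] [NormedAddCommGroup N] [NormedSpace ℂ N] (a : X →L[ℂ] N) (C : ℝ)
    (h : ∀ y : N, ‖y‖ ≤ 1 → ∃ x, ‖x‖ ≤ C ∧ ‖y - a x‖ ≤ 1 / 2) : Function.Surjective a := by
  have h' (y : N) : ∃ x, ‖x‖ ≤ C * ‖y‖ ∧ ‖y - a x‖ ≤ 1 / 2 * ‖y‖ := by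
    rcases eq_or_ne y 0 with rfl | hy
    · exact ⟨0, by simp⟩
    have hy' : (0 : ℝ) < ‖y‖ := norm_pos_iff.2 hy
    have hn : ‖((‖y‖ : ℝ) : ℂ)‖ = ‖y‖ := by simp
    have hne : ((‖y‖ : ℝ) : ℂ) ≠ 0 := by simpa using hy
    obtain ⟨x, hx, hxy⟩ := h (((‖y‖ : ℝ) : ℂ)⁻¹ • y) (by
      rw [norm_smul, norm_inv, hn, inv_mul_cancel₀ hy'.ne'])
    refine ⟨((‖y‖ : ℝ) : ℂ) • x, ?_, ?_⟩
    · rw [norm_smul, hn, mul_comm]; gcongr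
    · calc ‖y - a (((‖y‖ : ℝ) : ℂ) • x)‖
          = ‖((‖y‖ : ℝ) : ℂ) • ((((‖y‖ : ℝ) : ℂ)⁻¹ • y) - a x)‖ := by
            rw [smul_sub, smul_inv_smul₀ hne, map_smul]
        _ ≤ _ := by rw [norm_smul, hn, mul_comm]; gcongr
  choose g hg hg' using h'
  intro y
  -- Successive approximation: `s n` is the error left after `n` corrections, and it decays like
  -- `2⁻ⁿ`.
  let s : ℕ → N := fun n => (fun z => z - a (g z))^[n] y
  have hs (n : ℕ) : s (n + 1) = s n - a (g (s n)) := Function.iterate_succ_apply' _ n y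
  have hsn (n : ℕ) : ‖s n‖ ≤ (1 / 2) ^ n * ‖y‖ := by
    induction n with
    | zero => simp [s]
    | succ n ih =>
      rw [hs, pow_succ']
      refine (hg' (s n)).trans ?_
      rw [mul_assoc]; gcongr
  have hsum : Summable fun n => g (s n) := by
    refine Summable.of_norm_bounded (g := fun n => |C| * ((1 / 2) ^ n * ‖y‖))
      (((summable_geometric_two).mul_right _).mul_left _) fun n => ?_
    refine (hg (s n)).trans ?_
    exact mul_le_mul (le_abs_self C) (hsn n) (norm_nonneg _) (abs_nonneg C)
  refine ⟨∑' n, g (s n), ?_⟩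
  have hpart (n : ℕ) : ∑ i ∈ Finset.range n, a (g (s i)) = y - s n := by
    induction n with
    | zero => simp [s]
    | succ n ih => rw [Finset.sum_range_succ, ih, hs]; abel
  have h1 := ((hsum.hasSum.mapL a).tendsto_sum_nat)
  simp only [hpart] at h1
  have h2 : Tendsto s atTop (𝓝 0) := squeeze_zero_norm hsn (by
    simpa using (tendsto_pow_atTop_nhds_zero_of_lt_one (r := (1 / 2 : ℝ)) (by norm_num)
      (by norm_num)).mul_const ‖y‖)
  simpa using tendsto_nhds_unique h1 (tendsto_const_nhds.sub h2)

/-- If `A` acts on the cokernel of `a` and `A - c` is surjective on it for all `c`, then the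
cokernel is zero, even if the range of `a` is not known to be closed. -/
theorem surjective_of_forall_sub_smul_add {X N : Type*} [NormedAddCommGroup X] [NormedSpace ℂ X]
    [CompleteSpace X] [NormedAddCommGroup N] [NormedSpace ℂ N] [CompleteSpace N]
    (a : X →L[ℂ] N) (A : N →L[ℂ] N) (B : X →L[ℂ] X) (hAB : ∀ x, A (a x) = a (B x))
    (h : ∀ (c : ℂ) (y : N), ∃ n x, A n - c • n + a x = y) : Function.Surjective a := by
  -- On bounded sequences the range of `a` can be replaced by its closure `M`, so the quotient is a
  -- Banach space. If it vanishes, density of the range on sequences amounts to approximate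
  -- solvability of `a x = y` with a uniform bound, which already implies surjectivity.
  let aT : (ℕ →ᵇ X) →L[ℂ] (ℕ →ᵇ N) := a.compLeftContinuousBounded ℕ
  let AT : (ℕ →ᵇ N) →L[ℂ] (ℕ →ᵇ N) := A.compLeftContinuousBounded ℕ
  let BT : (ℕ →ᵇ X) →L[ℂ] (ℕ →ᵇ X) := B.compLeftContinuousBounded ℕ
  let M : Submodule ℂ (ℕ →ᵇ N) :=
    (LinearMap.range (aT : (ℕ →ᵇ X) →ₗ[ℂ] (ℕ →ᵇ N))).topologicalClosure
  have hM : IsClosed (M : Set (ℕ →ᵇ N)) := Submodule.isClosed_topologicalClosure _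
  have hAM : M ≤ M.comap (AT : (ℕ →ᵇ N) →ₗ[ℂ] (ℕ →ᵇ N)) := by
    refine Submodule.topologicalClosure_minimal _ ?_ (hM.preimage AT.continuous)
    rintro _ ⟨x, rfl⟩
    refine Submodule.le_topologicalClosure _ ⟨BT x, ?_⟩
    ext n
    exact (hAB (x n)).symm
  let Q := (ℕ →ᵇ N) ⧸ M
  have hsub : Subsingleton Q := by
    refine subsingleton_of_forall_surjective (M.liftQL (M.mkQL ∘L AT) fun y hy =>
      (Submodule.Quotient.mk_eq_zero M).2 (hAM hy)) fun c q => ?_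
    obtain ⟨y, rfl⟩ := Submodule.Quotient.mk_surjective M q
    let F : N × X →L[ℂ] N := (A - c • ContinuousLinearMap.id ℂ N).coprod a
    have hF : Function.Surjective F := fun y => by
      obtain ⟨n, x, hnx⟩ := h c y
      exact ⟨(n, x), by simpa [F] using hnx⟩
    -- The open mapping theorem for `(n, x) ↦ A n - c n + a x` provides bounded lifts, so a bounded
    -- sequence can be lifted term by term to bounded sequences.
    obtain ⟨C, hC, hpre⟩ := F.exists_preimage_norm_le hF
    choose g hg hgn using hpre
    have hgC (k : ℕ) : ‖g (y k)‖ ≤ C * ‖y‖ :=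
      (hgn _).trans (by gcongr; exact y.norm_coe_le_norm k)
    let n : ℕ →ᵇ N := ofNormedAddCommGroupDiscrete (fun k => (g (y k)).1) (C * ‖y‖)
      fun k => (norm_fst_le _).trans (hgC k)
    let x : ℕ →ᵇ X := ofNormedAddCommGroupDiscrete (fun k => (g (y k)).2) (C * ‖y‖)
      fun k => (norm_snd_le _).trans (hgC k)
    have hy : AT n - c • n + aT x = y := by
      ext k
      have hk := hg (y k)
      simp only [F, ContinuousLinearMap.coprod_apply] at hk
      exact hk
    refine ⟨Submodule.Quotient.mk n, ?_⟩
    have h0 : (Submodule.Quotient.mk (aT x) : Q) = 0 :=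
      (Submodule.Quotient.mk_eq_zero M).2 (Submodule.le_topologicalClosure _ ⟨x, rfl⟩)
    conv_rhs => rw [← hy, Submodule.Quotient.mk_add, h0, add_zero, Submodule.Quotient.mk_sub,
      Submodule.Quotient.mk_smul]
    rfl
  have hMtop (y : ℕ →ᵇ N) : y ∈ M := (Submodule.Quotient.mk_eq_zero M).1 (Subsingleton.elim _ _)
  have happ : ∃ C : ℕ, ∀ y : N, ‖y‖ ≤ 1 → ∃ x, ‖x‖ ≤ C ∧ ‖y - a x‖ ≤ 1 / 2 := by
    -- Otherwise choose for each `C` a vector `y C` of the unit ball which no `x` with `‖x‖ ≤ C`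
    -- approximates. The bounded sequence `y` lies in the closure of the range, and an approximant
    -- `x` contradicts the choice of `y k` as soon as `k ≥ ‖x‖`.
    by_contra! hcon
    choose y hy hyx using hcon
    obtain ⟨_, ⟨x, rfl⟩, hx⟩ := Metric.mem_closure_iff.1
      (hMtop (ofNormedAddCommGroupDiscrete y 1 hy)) (1 / 2) (by norm_num)
    obtain ⟨k, hk⟩ := exists_nat_ge ‖x‖
    have h1 := hyx k (x k) ((x.norm_coe_le_norm k).trans hk)
    have h2 := (dist_coe_le_dist k).trans_lt hx
    rw [dist_eq_norm] at h2
    exact lt_asymm h1 h2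
  obtain ⟨C, hC⟩ := happ
  exact surjective_of_approx a C hC

/-- If `f v` belongs to the spectrum of `s v` for all `v`, then `f` is invariant under every
endomorphism that `s` carries to an inner derivation. -/
theorem apply_eq_zero_of_mem_spectrum {V B : Type*} [AddCommGroup V] [Module ℂ V]
    [FiniteDimensional ℂ V] [NormedRing B] [NormedAlgebra ℂ B] [CompleteSpace B]
    (f : Module.Dual ℂ V) (D : Module.End ℂ V) (s : V →ₗ[ℂ] B) (X : B)
    (hs : ∀ v, s (D v) = s v * X - X * s v) (hf : ∀ v, f v ∈ spectrum ℂ (s v)) (v : V) :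
    f (D v) = 0 := by
  let b := Module.finBasis ℂ V
  let Φ : V ≃ₗ[ℂ] (Fin (Module.finrank ℂ V) → ℂ) := b.equivFun
  let f' : (Fin (Module.finrank ℂ V) → ℂ) →L[ℂ] ℂ := LinearMap.toContinuousLinearMap (f ∘ₗ Φ.symm.toLinearMap)
  let s' : (Fin (Module.finrank ℂ V) → ℂ) →L[ℂ] B := LinearMap.toContinuousLinearMap (s ∘ₗ Φ.symm.toLinearMap)
  let D' : (Fin (Module.finrank ℂ V) → ℂ) →L[ℂ] (Fin (Module.finrank ℂ V) → ℂ) :=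
    LinearMap.toContinuousLinearMap (Φ.toLinearMap ∘ₗ D ∘ₗ Φ.symm.toLinearMap)
  have hs' (w : (Fin (Module.finrank ℂ V) → ℂ)) : s' (D' w) = s' w * X - X * s' w := by simp [s', D', hs]
  have hf' (w : (Fin (Module.finrank ℂ V) → ℂ)) : f' w ∈ spectrum ℂ (s' w) := hf _
  let c : ℂ → (Fin (Module.finrank ℂ V) → ℂ) := fun t => NormedSpace.exp (t • D') (Φ v)
  have hc (t : ℂ) : HasDerivAt c (D' (c t)) t := by
    have := ((hasDerivAt_exp_smul_const' D' t).clm_apply (hasDerivAt_const t (Φ v)))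
    simpa [c] using this
  have hc0 : c 0 = Φ v := by
    refine (congrArg (fun T : (Fin (Module.finrank ℂ V) → ℂ) →L[ℂ] (Fin (Module.finrank ℂ V) → ℂ) =>
      NormedSpace.exp T (Φ v)) (zero_smul ℂ D')).trans ?_
    rw [NormedSpace.exp_zero]
    rfl
  -- The hypothesis on `s` says exactly that this conjugate has derivative zero. Hence `s' (c t)`
  -- has the same spectrum for all `t`, and the entire function `f' (c t)` is bounded, so it is
  -- constant by Liouville's theorem.
  let g : ℂ → B := fun t => NormedSpace.exp (t • X) * s' (c t) * NormedSpace.exp (t • (-X))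
  have hg (t : ℂ) : HasDerivAt g 0 t := by
    have h1 := ((hasDerivAt_exp_smul_const X t).mul
      (s'.hasFDerivAt.comp_hasDerivAt t (hc t))).mul (hasDerivAt_exp_smul_const' (-X) t)
    refine h1.congr_deriv ?_
    simp only [hs', Function.comp_apply, Pi.mul_apply]
    noncomm_ring
  have hgc (t : ℂ) : g t = s' (Φ v) := by
    rw [is_const_of_deriv_eq_zero (fun t => (hg t).differentiableAt) (fun t => (hg t).deriv) t 0]
    simp [g, hc0]
  have hcs (t : ℂ) : f' (c t) ∈ spectrum ℂ (s' (Φ v)) := by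
    let _ : NormedAlgebra ℚ B := NormedAlgebra.restrictScalars ℚ ℂ B
    let u : Bˣ := ⟨NormedSpace.exp (t • X), NormedSpace.exp (t • (-X)),
      by rw [smul_neg, ← NormedSpace.exp_add_of_commute (Commute.refl _).neg_right]; simp,
      by rw [smul_neg, ← NormedSpace.exp_add_of_commute (Commute.refl _).neg_left]; simp⟩
    rw [← hgc t]
    have : g t = u * s' (c t) * ↑u⁻¹ := rfl
    rw [this, spectrum.units_conjugate]
    exact hf' _
  have hdiff : Differentiable ℂ fun t => f' (c t) := fun t =>
    (f'.hasFDerivAt.comp_hasDerivAt t (hc t)).differentiableAt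
  have hconst (t : ℂ) : f' (c t) = f' (c 0) :=
    hdiff.apply_eq_apply_of_bounded ((spectrum.isBounded (s' (Φ v))).subset
      (Set.range_subset_iff.2 hcs)) t 0
  have h0 := f'.hasFDerivAt.comp_hasDerivAt 0 (hc 0)
  have h1 : HasDerivAt (fun t => f' (c t)) 0 0 := by
    simp only [hconst]
    exact hasDerivAt_const _ _
  simpa [hc0, f', D'] using h0.unique h1

end Banach

/-! ### Chains as tuples of vectors of `E`, which gives the chain spaces a Banach norm -/

section Coordinates

variable {E : Type*} [NormedAddCommGroup E] [NormedSpace ℂ E]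

/-- The coordinates on `E ⊗ W` given by a basis of `W`. -/
def tensorCoords (E : Type*) [NormedAddCommGroup E] [NormedSpace ℂ E] {W : Type*} [AddCommMonoid W]
    [Module ℂ W] {n : ℕ} (b : Module.Basis (Fin n) ℂ W) : E ⊗[ℂ] W ≃ₗ[ℂ] (Fin n → E) :=
  TensorProduct.equivFinsuppOfBasisRight b ≪≫ₗ Finsupp.linearEquivFunOnFinite ℂ E _

section

variable {W : Type*} [AddCommMonoid W] [Module ℂ W] {n : ℕ} (b : Module.Basis (Fin n) ℂ W)

theorem tensorCoords_tmul (e : E) (w : W) (i : Fin n) :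
    tensorCoords E b (e ⊗ₜ w) i = b.repr w i • e := by
  simp [tensorCoords]

theorem tensorCoords_symm_apply (v : Fin n → E) :
    (tensorCoords E b).symm v = ∑ i, v i ⊗ₜ b i := by
  rw [LinearEquiv.symm_apply_eq, map_sum]
  ext i
  simp [tensorCoords_tmul, Finsupp.single_apply]

theorem continuous_tensorCoords_tmul (w : W) :
    Continuous fun e : E => tensorCoords E b (e ⊗ₜ w) :=
  continuous_pi fun i => by
    simp only [tensorCoords_tmul]
    exact continuous_const_smul _

theorem continuous_tensorCoords_symm {Z : Type*} [NormedAddCommGroup Z] [NormedSpace ℂ Z]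
    (T : E ⊗[ℂ] W →ₗ[ℂ] Z) (hT : ∀ w, Continuous fun e => T (e ⊗ₜ w)) :
    Continuous fun v => T ((tensorCoords E b).symm v) := by
  simp only [tensorCoords_symm_apply, map_sum]
  exact continuous_finsetSum _ fun i _ => (hT (b i)).comp (continuous_apply i)

end

variable {L : Type*} [LieRing L] [LieAlgebra ℂ L] [FiniteDimensional ℂ L]

/-- Coordinates on `E ⊗ ⋀^p L`. -/
def chainCoords (E L : Type*) [NormedAddCommGroup E] [NormedSpace ℂ E] [LieRing L]
    [LieAlgebra ℂ L] [FiniteDimensional ℂ L] (p : ℕ) :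
    E ⊗[ℂ] ⋀[ℂ]^p L ≃ₗ[ℂ] (Fin (Module.finrank ℂ (⋀[ℂ]^p L)) → E) :=
  tensorCoords E (Module.finBasis ℂ (⋀[ℂ]^p L))

theorem continuous_chainCoords_tmul (p : ℕ) (ω : ⋀[ℂ]^p L) :
    Continuous fun e : E => chainCoords E L p (e ⊗ₜ ω) :=
  continuous_tensorCoords_tmul _ ω

/-- `tensorAction` as a bounded operator, in coordinates. -/
def tensorActionL (A : E →L[ℂ] E) (D : Module.End ℂ L) (p : ℕ) :
    (Fin (Module.finrank ℂ (⋀[ℂ]^p L)) → E) →L[ℂ] (Fin (Module.finrank ℂ (⋀[ℂ]^p L)) → E) where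
  toLinearMap := (chainCoords E L p).toLinearMap ∘ₗ tensorAction (A : Module.End ℂ E) D p ∘ₗ
    (chainCoords E L p).symm.toLinearMap
  cont := continuous_tensorCoords_symm (Module.finBasis ℂ (⋀[ℂ]^p L))
    ((chainCoords E L p).toLinearMap ∘ₗ tensorAction (A : Module.End ℂ E) D p) fun ω => by
      simp only [LinearMap.comp_apply, tensorAction_tmul, map_sub]
      exact ((continuous_chainCoords_tmul p ω).comp A.continuous).sub
        (continuous_chainCoords_tmul p _)

theorem tensorActionL_apply (A : E →L[ℂ] E) (D : Module.End ℂ L) (p : ℕ)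
    (u : E ⊗[ℂ] ⋀[ℂ]^p L) :
    tensorActionL A D p (chainCoords E L p u) =
      chainCoords E L p (tensorAction (A : Module.End ℂ E) D p u) := by
  change chainCoords E L p (tensorAction _ D p ((chainCoords E L p).symm _)) = _
  rw [LinearEquiv.symm_apply_apply]

/-- The boundary as a bounded operator, in coordinates. -/
def boundarySuccL (ρ : L →ₗ[ℂ] E →L[ℂ] E) (f : Module.Dual ℂ L) (p : ℕ) :
    (Fin (Module.finrank ℂ (⋀[ℂ]^(p + 1) L)) → E) →L[ℂ]
      (Fin (Module.finrank ℂ (⋀[ℂ]^p L)) → E) where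
  toLinearMap := (chainCoords E L p).toLinearMap ∘ₗ boundarySucc ρ f p ∘ₗ
    (chainCoords E L (p + 1)).symm.toLinearMap
  cont := continuous_tensorCoords_symm (Module.finBasis ℂ (⋀[ℂ]^(p + 1) L))
    ((chainCoords E L p).toLinearMap ∘ₗ boundarySucc ρ f p) fun ω => by
      simp only [LinearMap.comp_apply, boundarySucc_tmul, map_add]
      refine Continuous.add ?_ (continuous_chainCoords_tmul p _)
      induction removeOne L p ω using TensorProduct.induction_on with
      | zero => simpa using continuous_const
      | tmul a b =>
        have h : Continuous fun e => ρ a e - f a • e := by fun_prop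
        exact (continuous_chainCoords_tmul p b).comp h
      | add a b ha hb =>
        simp only [map_add]
        exact ha.add hb

theorem boundarySuccL_apply (ρ : L →ₗ[ℂ] E →L[ℂ] E) (f : Module.Dual ℂ L) (p : ℕ)
    (u : E ⊗[ℂ] ⋀[ℂ]^(p + 1) L) :
    boundarySuccL ρ f p (chainCoords E L (p + 1) u) =
      chainCoords E L p (boundarySucc ρ f p u) := by
  change chainCoords E L p (boundarySucc ρ f p ((chainCoords E L (p + 1)).symm _)) = _
  rw [LinearEquiv.symm_apply_apply]

end Coordinates

/-! ### Points of the spectrum vanish on images of induced derivations -/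

section Invariance

variable {L : Type*} [LieRing L] [LieAlgebra ℂ L]
  {E : Type*} [NormedAddCommGroup E] [NormedSpace ℂ E]

theorem tensorAction_add (A A' : Module.End ℂ E) (D D' : Module.End ℂ L) (p : ℕ) :
    tensorAction (A + A') (D + D') p = tensorAction A D p + tensorAction A' D' p := by
  have h : derivExt (D + D') p = derivExt D p + derivExt D' p := by
    cases p with
    | zero => exact (add_zero (0 : Module.End ℂ (⋀[ℂ]^0 L))).symm
    | succ p =>
      simp only [derivExt, LinearMap.rTensor_add, LinearMap.add_comp, LinearMap.comp_add]
  rw [tensorAction, h, LinearMap.rTensor_add, LinearMap.lTensor_add, add_sub_add_comm]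
  rfl

theorem tensorAction_smul (c : ℂ) (A : Module.End ℂ E) (D : Module.End ℂ L) (p : ℕ) :
    tensorAction (c • A) (c • D) p = c • tensorAction A D p := by
  have h : derivExt (c • D) p = c • derivExt D p := by
    cases p with
    | zero => exact (smul_zero (A := Module.End ℂ (⋀[ℂ]^0 L)) c).symm
    | succ p =>
      simp only [derivExt, LinearMap.rTensor_smul, LinearMap.smul_comp, LinearMap.comp_smul]
  refine TensorProduct.ext' fun e ω => ?_
  simp only [tensorAction_tmul, h, LinearMap.smul_apply, smul_sub, TensorProduct.smul_tmul',
    TensorProduct.tmul_smul]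

theorem tensorAction_sub_smul (c : ℂ) (A : Module.End ℂ E) (D : Module.End ℂ L) (p : ℕ)
    (u : E ⊗[ℂ] ⋀[ℂ]^p L) :
    tensorAction (A - c • 1) D p u = tensorAction A D p u - c • u := by
  induction u using TensorProduct.induction_on with
  | zero => simp
  | tmul e ω =>
    simp only [tensorAction_tmul, LinearMap.sub_apply, LinearMap.smul_apply, Module.End.one_apply,
      TensorProduct.sub_tmul, TensorProduct.smul_tmul']
    abel
  | add u v hu hv => simp only [map_add, smul_add, hu, hv]; abel

theorem range_le_ker (ρ : L →ₗ[ℂ] E →L[ℂ] E)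
    (hρ : ∀ (x y : L) (e : E), ρ ⁅x, y⁆ e = ρ y (ρ x e) - ρ x (ρ y e))
    (f : Module.Dual ℂ L) (hf : ∀ x y : L, f ⁅x, y⁆ = 0) (p : ℕ) :
    LinearMap.range (boundarySucc ρ f p) ≤ LinearMap.ker (boundary ρ f p) := by
  rintro _ ⟨u, rfl⟩
  cases p with
  | zero => rfl
  | succ p => exact boundarySucc_boundarySucc ρ hρ f hf p u

theorem boundarySucc_wedge_of_mem_ker (ρ : L →ₗ[ℂ] E →L[ℂ] E) (f : Module.Dual ℂ L) (p : ℕ)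
    (y : L) (u : E ⊗[ℂ] ⋀[ℂ]^p L) (hu : boundary ρ f p u = 0) :
    boundarySucc ρ f p ((wedge p y).lTensor E u) =
      tensorAction (shift ρ f y) (LieAlgebra.ad ℂ L y) p u := by
  cases p with
  | zero => exact boundarySucc_wedge_zero ρ f y u
  | succ p =>
    rw [boundarySucc_wedge_succ, show boundarySucc ρ f p u = 0 from hu, map_zero, sub_zero]

/-- For a cycle `u`, write `y ∧ u = θ(y) v`. Then `θ(y) u = d(y ∧ u) = d θ(y) v = θ(y) d v`, and
injectivity gives `u = d v`. -/
theorem range_eq_ker_of_bijective (ρ : L →ₗ[ℂ] E →L[ℂ] E)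
    (hρ : ∀ (x y : L) (e : E), ρ ⁅x, y⁆ e = ρ y (ρ x e) - ρ x (ρ y e))
    (f : Module.Dual ℂ L) (hf : ∀ x y : L, f ⁅x, y⁆ = 0) (p : ℕ) (y : L)
    (hinj : Function.Injective (tensorAction (shift ρ f y) (LieAlgebra.ad ℂ L y) p))
    (hsurj : Function.Surjective (tensorAction (shift ρ f y) (LieAlgebra.ad ℂ L y) (p + 1))) :
    LinearMap.range (boundarySucc ρ f p) = LinearMap.ker (boundary ρ f p) := by
  refine le_antisymm (range_le_ker ρ hρ f hf p) fun u hu => ?_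
  obtain ⟨v, hv⟩ := hsurj ((wedge p y).lTensor E u)
  refine ⟨v, hinj ?_⟩
  rw [← boundarySucc_wedge_of_mem_ker ρ f p y u hu, ← hv,
    boundarySucc_tensorAction ρ f _ _ (by simp) (fun z => by simp [hf])
      (fun z e => by simp [shift_apply, hρ])]

/-- Elements of the spectrum are invariant under derivations induced by bounded operators. -/
theorem apply_derivation_eq_zero [CompleteSpace E] [FiniteDimensional ℂ L]
    (ρ : L →ₗ[ℂ] E →L[ℂ] E)
    (hρ : ∀ (x y : L) (e : E), ρ ⁅x, y⁆ e = ρ y (ρ x e) - ρ x (ρ y e))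
    (A : E →L[ℂ] E) (D : Module.End ℂ L) (hD : ∀ y z, D ⁅y, z⁆ = ⁅D y, z⁆ + ⁅y, D z⁆)
    (hA : ∀ y e, ρ (D y) e = ρ y (A e) - A (ρ y e))
    {p : ℕ} {f : Module.Dual ℂ L} (hf : f ∈ sigmaDegree ρ p) (y : L) : f (D y) = 0 := by
  let S (p : ℕ) : L →ₗ[ℂ] ((Fin (Module.finrank ℂ (⋀[ℂ]^p L)) → E) →L[ℂ]
      (Fin (Module.finrank ℂ (⋀[ℂ]^p L)) → E)) :=
    { toFun := fun y => tensorActionL (ρ y) (LieAlgebra.ad ℂ L y) p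
      map_add' := fun y z => ContinuousLinearMap.ext fun v => by
        obtain ⟨u, rfl⟩ := (chainCoords E L p).surjective v
        rw [_root_.add_apply, tensorActionL_apply, tensorActionL_apply, tensorActionL_apply,
          ← map_add (chainCoords E L p), map_add ρ, map_add (LieAlgebra.ad ℂ L)]
        exact congrArg _ (LinearMap.congr_fun (tensorAction_add _ _ _ _ p) u)
      map_smul' := fun c y => ContinuousLinearMap.ext fun v => by
        obtain ⟨u, rfl⟩ := (chainCoords E L p).surjective v
        rw [_root_.smul_apply, tensorActionL_apply, tensorActionL_apply,
          ← map_smulₛₗ (chainCoords E L p), map_smul ρ, map_smul (LieAlgebra.ad ℂ L)]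
        exact congrArg _ (LinearMap.congr_fun (tensorAction_smul c _ _ p) u) }
  have hSapp (p : ℕ) (y : L) (u : E ⊗[ℂ] ⋀[ℂ]^p L) : S p y (chainCoords E L p u) =
      chainCoords E L p (tensorAction (ρ y : Module.End ℂ E) (LieAlgebra.ad ℂ L y) p u) :=
    tensorActionL_apply _ _ _ _
  have hS (p : ℕ) (y : L) :
      S p (D y) = S p y * tensorActionL A D p - tensorActionL A D p * S p y := by
    refine ContinuousLinearMap.ext fun v => ?_
    obtain ⟨u, rfl⟩ := (chainCoords E L p).surjective v
    have := LinearMap.congr_fun (tensorAction_commutator (A : Module.End ℂ E)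
      (ρ y : Module.End ℂ E) D (LieAlgebra.ad ℂ L y) p) u
    simp only [LinearMap.sub_apply, Module.End.mul_apply] at this
    rw [_root_.sub_apply, ContinuousLinearMap.mul_def, ContinuousLinearMap.mul_def,
      ContinuousLinearMap.comp_apply, ContinuousLinearMap.comp_apply, hSapp, hSapp, tensorActionL_apply, tensorActionL_apply, hSapp, ← map_sub, ← this]
    congr 3
    · ext e
      simp [hA]
    · ext z
      simp [hD]
  -- The product algebra is used because the spectrum of a pair is the union of the two spectra: if
  -- `f v` were outside it, `θ(v)` would be invertible in degrees `p` and `p + 1`, which forces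
  -- exactness in degree `p`.
  refine apply_eq_zero_of_mem_spectrum f D ((S p).prod (S (p + 1)))
    (tensorActionL A D p, tensorActionL A D (p + 1)) (fun v => Prod.ext (hS p v) (hS (p + 1) v))
    (fun v hv => hf.2 ?_) y
  obtain ⟨h1, h2⟩ := Prod.isUnit_iff.1 hv
  have hshift (p : ℕ) (u : E ⊗[ℂ] ⋀[ℂ]^p L) :
      chainCoords E L p (tensorAction (shift ρ f v) (LieAlgebra.ad ℂ L v) p u) =
      -(algebraMap ℂ ((Fin (Module.finrank ℂ (⋀[ℂ]^p L)) → E) →L[ℂ]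
        (Fin (Module.finrank ℂ (⋀[ℂ]^p L)) → E)) (f v) - S p v) (chainCoords E L p u) := by
    have h : tensorAction (shift ρ f v) (LieAlgebra.ad ℂ L v) p u =
        tensorAction (ρ v : Module.End ℂ E) (LieAlgebra.ad ℂ L v) p u - f v • u := by
      rw [shift, tensorAction_sub_smul]
    rw [h, _root_.sub_apply, hSapp, Algebra.algebraMap_eq_smul_one, map_sub, map_smul, neg_sub]
    rfl
  have hshift' (p : ℕ) : (tensorAction (shift ρ f v) (LieAlgebra.ad ℂ L v) p : _ → _) =
      (chainCoords E L p).symm ∘ Neg.neg ∘ (algebraMap ℂ ((Fin (Module.finrank ℂ (⋀[ℂ]^p L)) → E)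
        →L[ℂ] (Fin (Module.finrank ℂ (⋀[ℂ]^p L)) → E)) (f v) - S p v) ∘ chainCoords E L p :=
    funext fun u => (chainCoords E L p).injective <| by
      simp only [Function.comp_apply, hshift, LinearEquiv.apply_symm_apply]
  refine range_eq_ker_of_bijective ρ hρ f hf.1 p v ?_ ?_
  · rw [hshift']
    exact (chainCoords E L p).symm.injective.comp (neg_injective.comp
      ((ContinuousLinearMap.isUnit_iff_bijective.1 h1).1.comp (chainCoords E L p).injective))
  · rw [hshift']
    exact (chainCoords E L _).symm.surjective.comp (neg_surjective.comp
      ((ContinuousLinearMap.isUnit_iff_bijective.1 h2).2.comp (chainCoords E L _).surjective))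

end Invariance

/-! ### Contraction with a linear form -/

section Contraction

variable {K L : Type*} [LieRing K] [LieAlgebra ℂ K] [LieRing L] [LieAlgebra ℂ L]

/-- Contraction `⋀^(p+1) L → ⋀^p L` with a linear form. -/
def contract (g : Module.Dual ℂ L) (p : ℕ) : ⋀[ℂ]^(p + 1) L →ₗ[ℂ] ⋀[ℂ]^p L :=
  TensorProduct.lift ((LinearMap.lsmul ℂ (⋀[ℂ]^p L)).comp g) ∘ₗ removeOne L p

theorem contract_wedge_zero (g : Module.Dual ℂ L) (y : L) (ω : ⋀[ℂ]^0 L) :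
    contract g 0 (wedge 0 y ω) = g y • ω := by
  simp [contract, removeOne_wedge_zero]

theorem contract_wedge_succ (g : Module.Dual ℂ L) (p : ℕ) (y : L) (ω : ⋀[ℂ]^(p + 1) L) :
    contract g (p + 1) (wedge (p + 1) y ω) = g y • ω - wedge p y (contract g p ω) := by
  have h (t : L ⊗[ℂ] ⋀[ℂ]^p L) :
      TensorProduct.lift ((LinearMap.lsmul ℂ (⋀[ℂ]^(p + 1) L)).comp g) ((wedge p y).lTensor L t) =
        wedge p y (TensorProduct.lift ((LinearMap.lsmul ℂ (⋀[ℂ]^p L)).comp g) t) := by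
    induction t using TensorProduct.induction_on with
    | zero => simp
    | tmul a b => simp
    | add a b ha hb => simp only [map_add, ha, hb]
  simp only [contract, LinearMap.comp_apply, removeOne_wedge, map_sub, h]
  simp

theorem contract_map (g : Module.Dual ℂ L) (j : K →ₗ[ℂ] L) (hg : ∀ k, g (j k) = 0) (p : ℕ)
    (ω : ⋀[ℂ]^(p + 1) K) : contract g p (exteriorPower.map (p + 1) j ω) = 0 := by
  induction p with
  | zero =>
    refine LinearMap.congr_fun (f := contract g 0 ∘ₗ exteriorPower.map 1 j) (g := 0)
      (hom_ext_wedge fun y => LinearMap.ext fun ω => ?_) ω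
    have := LinearMap.congr_fun (map_wedge j 0 y) ω
    simp only [LinearMap.comp_apply] at this ⊢
    rw [this, contract_wedge_zero, hg, zero_smul]
    rfl
  | succ p ih =>
    refine LinearMap.congr_fun (f := contract g (p + 1) ∘ₗ exteriorPower.map (p + 2) j) (g := 0)
      (hom_ext_wedge fun y => LinearMap.ext fun ω => ?_) ω
    have := LinearMap.congr_fun (map_wedge j (p + 1) y) ω
    simp only [LinearMap.comp_apply] at this ⊢
    rw [this, contract_wedge_succ, hg, zero_smul, ih, map_zero, sub_zero]
    rfl

end Contraction

/-! ### Ideals of codimension one: the complex of `L` as a mapping cone -/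

section CodimOne

/-- A splitting `L = j K ⊕ ℂ x`, where `j K` is an ideal of `L`. -/
structure Splitting {K L : Type*} [LieRing K] [LieAlgebra ℂ K] [LieRing L] [LieAlgebra ℂ L]
    (j : K →ₗ⁅ℂ⁆ L) where
  /-- The projection onto `K`. -/
  proj : L →ₗ[ℂ] K
  /-- The coordinate along `x`. -/
  coord : Module.Dual ℂ L
  /-- The complementary vector `x`. -/
  vec : L
  proj_apply : ∀ k, proj (j k) = k
  coord_vec : coord vec = 1
  decomp : ∀ y, j (proj y) + coord y • vec = y
  coord_lie : ∀ y z : L, coord ⁅y, z⁆ = 0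

namespace Splitting

variable {K L : Type*} [LieRing K] [LieAlgebra ℂ K] [LieRing L] [LieAlgebra ℂ L]
  {E : Type*} [NormedAddCommGroup E] [NormedSpace ℂ E] {j : K →ₗ⁅ℂ⁆ L} (s : Splitting j)

theorem injective (s : Splitting j) : Function.Injective j := Function.LeftInverse.injective s.proj_apply

theorem vec_ne_zero : s.vec ≠ 0 := fun h => by simpa [h] using s.coord_vec

theorem coord_apply (k : K) : s.coord (j k) = 0 := by
  have := s.decomp (j k)
  rw [s.proj_apply, add_eq_left] at this
  exact (smul_eq_zero.1 this).resolve_right s.vec_ne_zero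

theorem proj_vec : s.proj s.vec = 0 := by
  have := s.decomp s.vec
  rw [s.coord_vec, one_smul, add_eq_right] at this
  exact s.injective (this.trans (map_zero j).symm)

/-- The endomorphism `k ↦ [y, k]` of `K`. -/
def ad (y : L) : Module.End ℂ K := s.proj ∘ₗ LieAlgebra.ad ℂ L y ∘ₗ (j : K →ₗ[ℂ] L)

theorem apply_ad (y : L) (k : K) : j (s.ad y k) = ⁅y, j k⁆ := by
  have := s.decomp ⁅y, j k⁆
  rwa [s.coord_lie, zero_smul, add_zero] at this

theorem ad_lie (y : L) (k l : K) : s.ad y ⁅k, l⁆ = ⁅s.ad y k, l⁆ + ⁅k, s.ad y l⁆ :=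
  s.injective (by simp [apply_ad])

theorem tensorMap_proj (p : ℕ) (a : E ⊗[ℂ] ⋀[ℂ]^p K) :
    tensorMap E s.proj p (tensorMap E (j : K →ₗ[ℂ] L) p a) = a := by
  rw [tensorMap, tensorMap, ← LinearMap.lTensor_comp_apply, ← exteriorPower.map_comp,
    show s.proj ∘ₗ (j : K →ₗ[ℂ] L) = LinearMap.id from LinearMap.ext s.proj_apply,
    exteriorPower.map_id, LinearMap.lTensor_id, LinearMap.id_apply]

theorem tensorMap_injective (s : Splitting j) (p : ℕ) :
    Function.Injective (tensorMap E (j : K →ₗ[ℂ] L) p) :=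
  Function.LeftInverse.injective (s.tensorMap_proj p)

/-- Uniqueness of the decomposition `a + x ∧ b` of a chain. The projection to `K` kills `x` and
recovers `a`; contraction with `coord` kills chains of `K` and recovers `b`. -/
theorem tensorMap_add_wedge_eq_zero (p : ℕ) (a : E ⊗[ℂ] ⋀[ℂ]^(p + 1) K) (b : E ⊗[ℂ] ⋀[ℂ]^p K)
    (h : tensorMap E (j : K →ₗ[ℂ] L) (p + 1) a +
      (wedge p s.vec).lTensor E (tensorMap E (j : K →ₗ[ℂ] L) p b) = 0) : a = 0 ∧ b = 0 := by
  have ha : a = 0 := by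
    have := congrArg (tensorMap E s.proj (p + 1)) h
    rwa [map_add, s.tensorMap_proj, tensorMap_wedge, s.proj_vec, map_zero, LinearMap.lTensor_zero,
      LinearMap.zero_apply, add_zero, map_zero] at this
  refine ⟨ha, ?_⟩
  rw [ha, map_zero, zero_add] at h
  have hc : contract s.coord p ∘ₗ wedge p s.vec ∘ₗ exteriorPower.map p (j : K →ₗ[ℂ] L) =
      exteriorPower.map p (j : K →ₗ[ℂ] L) := by
    refine LinearMap.ext fun ω => ?_
    simp only [LinearMap.comp_apply]
    cases p with
    | zero => rw [contract_wedge_zero, s.coord_vec, one_smul]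
    | succ p =>
      rw [contract_wedge_succ, s.coord_vec, one_smul, contract_map _ _ s.coord_apply, map_zero,
        sub_zero]
  have := congrArg ((contract s.coord p).lTensor E) h
  rw [tensorMap, ← LinearMap.lTensor_comp_apply, ← LinearMap.lTensor_comp_apply,
    LinearMap.comp_assoc, hc, map_zero] at this
  rw [← s.tensorMap_proj p b, tensorMap, tensorMap, this, map_zero]

theorem exists_tensorMap_zero (s : Splitting j) (u : E ⊗[ℂ] ⋀[ℂ]^0 L) :
    ∃ a, tensorMap E (j : K →ₗ[ℂ] L) 0 a = u := by
  refine ⟨tensorMap E s.proj 0 u, ?_⟩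
  have : exteriorPower.map 0 (j : K →ₗ[ℂ] L) ∘ₗ exteriorPower.map 0 s.proj = LinearMap.id :=
    hom_ext_ιMulti fun z => by
      simp only [LinearMap.comp_apply, exteriorPower.map_apply_ιMulti, LinearMap.id_apply]
      congr 1
      exact Subsingleton.elim _ _
  rw [tensorMap, tensorMap, ← LinearMap.lTensor_comp_apply, this, LinearMap.lTensor_id,
    LinearMap.id_apply]

theorem wedge_tensorMap (y : L) (p : ℕ) (a : E ⊗[ℂ] ⋀[ℂ]^p K) :
    (wedge p y).lTensor E (tensorMap E (j : K →ₗ[ℂ] L) p a) =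
      tensorMap E (j : K →ₗ[ℂ] L) (p + 1) ((wedge p (s.proj y)).lTensor E a) +
        (wedge p s.vec).lTensor E (tensorMap E (j : K →ₗ[ℂ] L) p (s.coord y • a)) := by
  rw [tensorMap_wedge, LieHom.coe_toLinearMap]
  conv_lhs => rw [← s.decomp y, map_add, map_smul, LinearMap.lTensor_add, LinearMap.lTensor_smul]
  rw [map_smul, map_smul]
  rfl

theorem wedge_vec_wedge (y : L) (p : ℕ) (u : E ⊗[ℂ] ⋀[ℂ]^p L) :
    (wedge (p + 1) y).lTensor E ((wedge p s.vec).lTensor E u) =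
      -(wedge (p + 1) s.vec).lTensor E ((wedge p y).lTensor E u) := by
  induction u using TensorProduct.induction_on with
  | zero => simp
  | tmul e ω =>
    simp only [LinearMap.lTensor_tmul]
    rw [wedge_comm, TensorProduct.tmul_neg]
  | add u v hu hv => simp only [map_add, neg_add, hu, hv]

theorem wedge_vec_wedge_self (p : ℕ) (u : E ⊗[ℂ] ⋀[ℂ]^p L) :
    (wedge (p + 1) s.vec).lTensor E ((wedge p s.vec).lTensor E u) = 0 := by
  induction u using TensorProduct.induction_on with
  | zero => simp
  | tmul e ω => simp only [LinearMap.lTensor_tmul, wedge_self, TensorProduct.tmul_zero]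
  | add u v hu hv => simp only [map_add, hu, hv, add_zero]

/-- Existence of the decomposition `a + x ∧ b`: the chains of this form are stable under exterior
multiplication by any vector, as one sees by splitting it into its components along `K` and `x`. -/
theorem exists_tensorMap_add_wedge (p : ℕ) (u : E ⊗[ℂ] ⋀[ℂ]^(p + 1) L) :
    ∃ a b, tensorMap E (j : K →ₗ[ℂ] L) (p + 1) a +
      (wedge p s.vec).lTensor E (tensorMap E (j : K →ₗ[ℂ] L) p b) = u := by
  let R (p : ℕ) : Submodule ℂ (E ⊗[ℂ] ⋀[ℂ]^(p + 1) L) :=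
    LinearMap.range ((tensorMap E (j : K →ₗ[ℂ] L) (p + 1)).coprod
      ((wedge p s.vec).lTensor E ∘ₗ tensorMap E (j : K →ₗ[ℂ] L) p))
  have hR (p : ℕ) (h : ∀ y u, (wedge p y).lTensor E u ∈ R p) (u : E ⊗[ℂ] ⋀[ℂ]^(p + 1) L) :
      u ∈ R p := by
    have : (R p).mkQ = 0 := hom_ext_tensor_wedge fun y u => by
      simpa using h y u
    rw [← Submodule.Quotient.mk_eq_zero]
    exact LinearMap.congr_fun this u
  suffices h : ∀ p u, u ∈ R p by
    obtain ⟨⟨a, b⟩, hab⟩ := h p u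
    exact ⟨a, b, by simpa using hab⟩
  intro p
  induction p with
  | zero =>
    refine hR 0 fun y u => ?_
    obtain ⟨a, rfl⟩ := s.exists_tensorMap_zero u
    exact ⟨((wedge 0 (s.proj y)).lTensor E a, s.coord y • a), by
      rw [wedge_tensorMap s]; simp⟩
  | succ p ih =>
    refine hR (p + 1) fun y u => ?_
    obtain ⟨⟨a, b⟩, rfl⟩ := ih u
    refine ⟨((wedge (p + 1) (s.proj y)).lTensor E a,
      s.coord y • a - (wedge p (s.proj y)).lTensor E b), ?_⟩
    simp only [LinearMap.coprod_apply, LinearMap.comp_apply, map_add, map_sub]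
    rw [s.wedge_tensorMap y (p + 1), s.wedge_vec_wedge, s.wedge_tensorMap y p, map_add,
      s.wedge_vec_wedge_self, add_zero]
    abel

theorem boundarySucc_wedge_vec_zero (ρ : L →ₗ[ℂ] E →L[ℂ] E) (f : Module.Dual ℂ L)
    (b : E ⊗[ℂ] ⋀[ℂ]^0 K) :
    boundarySucc ρ f 0 ((wedge 0 s.vec).lTensor E (tensorMap E (j : K →ₗ[ℂ] L) 0 b)) =
      tensorMap E (j : K →ₗ[ℂ] L) 0 (tensorAction (shift ρ f s.vec) (s.ad s.vec) 0 b) := by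
  rw [boundarySucc_wedge_zero, tensorMap_tensorAction]
  exact LinearMap.ext fun k => s.apply_ad s.vec k

theorem boundarySucc_wedge_vec_succ (ρ : L →ₗ[ℂ] E →L[ℂ] E) (f : Module.Dual ℂ L) (p : ℕ)
    (b : E ⊗[ℂ] ⋀[ℂ]^(p + 1) K) :
    boundarySucc ρ f (p + 1)
        ((wedge (p + 1) s.vec).lTensor E (tensorMap E (j : K →ₗ[ℂ] L) (p + 1) b)) =
      tensorMap E (j : K →ₗ[ℂ] L) (p + 1)
          (tensorAction (shift ρ f s.vec) (s.ad s.vec) (p + 1) b) -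
        (wedge p s.vec).lTensor E (tensorMap E (j : K →ₗ[ℂ] L) p
          (boundarySucc (ρ ∘ₗ (j : K →ₗ[ℂ] L)) (f ∘ₗ (j : K →ₗ[ℂ] L)) p b)) := by
  rw [boundarySucc_wedge_succ, boundarySucc_tensorMap, tensorMap_tensorAction]
  exact LinearMap.ext fun k => s.apply_ad s.vec k

/-- The mapping cone formula `d(a + x ∧ b) = (d a + θ(x) b) - x ∧ d b`, compared componentwise with
a chain `c` of `K`. -/
theorem boundarySucc_eq_tensorMap_iff (ρ : L →ₗ[ℂ] E →L[ℂ] E) (f : Module.Dual ℂ L) (p : ℕ)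
    (a : E ⊗[ℂ] ⋀[ℂ]^(p + 1) K) (b c : E ⊗[ℂ] ⋀[ℂ]^p K) :
    boundarySucc ρ f p (tensorMap E (j : K →ₗ[ℂ] L) (p + 1) a +
        (wedge p s.vec).lTensor E (tensorMap E (j : K →ₗ[ℂ] L) p b)) =
        tensorMap E (j : K →ₗ[ℂ] L) p c ↔
      boundarySucc (ρ ∘ₗ (j : K →ₗ[ℂ] L)) (f ∘ₗ (j : K →ₗ[ℂ] L)) p a +
        tensorAction (shift ρ f s.vec) (s.ad s.vec) p b = c ∧
      boundary (ρ ∘ₗ (j : K →ₗ[ℂ] L)) (f ∘ₗ (j : K →ₗ[ℂ] L)) p b = 0 := by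
  rw [map_add, boundarySucc_tensorMap]
  cases p with
  | zero =>
    rw [boundarySucc_wedge_vec_zero, ← map_add, (s.tensorMap_injective 0).eq_iff]
    exact (and_iff_left rfl).symm
  | succ p =>
    rw [boundarySucc_wedge_vec_succ, ← sub_eq_zero, ← sub_eq_zero (b := c)]
    constructor
    · intro h
      have h' := s.tensorMap_add_wedge_eq_zero p
        (boundarySucc (ρ ∘ₗ (j : K →ₗ[ℂ] L)) (f ∘ₗ (j : K →ₗ[ℂ] L)) (p + 1) a +
          tensorAction (shift ρ f s.vec) (s.ad s.vec) (p + 1) b - c)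
        (-boundarySucc (ρ ∘ₗ (j : K →ₗ[ℂ] L)) (f ∘ₗ (j : K →ₗ[ℂ] L)) p b) (by
          rw [← h, map_sub, map_add, map_neg, map_neg]; abel)
      exact ⟨h'.1, neg_eq_zero.1 h'.2⟩
    · rintro ⟨h, hb⟩
      rw [show boundarySucc (ρ ∘ₗ (j : K →ₗ[ℂ] L)) (f ∘ₗ (j : K →ₗ[ℂ] L)) p b = 0 from hb,
        map_zero, map_zero, sub_zero, ← map_add, ← map_sub, h, map_zero]

/-- Exactness of the complex of the ideal in degrees `≤ p` gives exactness in degree `p`. -/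
theorem range_eq_ker (s : Splitting j) (ρ : L →ₗ[ℂ] E →L[ℂ] E)
    (hρ : ∀ (x y : L) (e : E), ρ ⁅x, y⁆ e = ρ y (ρ x e) - ρ x (ρ y e))
    (f : Module.Dual ℂ L) (hf : ∀ x y : L, f ⁅x, y⁆ = 0) (p : ℕ)
    (h : ∀ q ≤ p, LinearMap.range
        (boundarySucc (ρ ∘ₗ (j : K →ₗ[ℂ] L)) (f ∘ₗ (j : K →ₗ[ℂ] L)) q) =
      LinearMap.ker (boundary (ρ ∘ₗ (j : K →ₗ[ℂ] L)) (f ∘ₗ (j : K →ₗ[ℂ] L)) q)) :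
    LinearMap.range (boundarySucc ρ f p) = LinearMap.ker (boundary ρ f p) := by
  refine le_antisymm (range_le_ker ρ hρ f hf p) fun u hu => ?_
  cases p with
  | zero =>
    obtain ⟨a, rfl⟩ := s.exists_tensorMap_zero u
    obtain ⟨b, rfl⟩ := (h 0 le_rfl).ge (show a ∈ _ from rfl)
    exact ⟨tensorMap E (j : K →ₗ[ℂ] L) 1 b, boundarySucc_tensorMap ρ f j 0 b⟩
  | succ p =>
    obtain ⟨a, b, rfl⟩ := s.exists_tensorMap_add_wedge p u
    obtain ⟨hab, hb⟩ := (s.boundarySucc_eq_tensorMap_iff ρ f p a b 0).1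
      ((show boundarySucc ρ f p _ = 0 from hu).trans (map_zero _).symm)
    obtain ⟨c, rfl⟩ := (h p p.le_succ).ge hb
    have hcomm := boundarySucc_tensorAction (ρ ∘ₗ (j : K →ₗ[ℂ] L)) (f ∘ₗ (j : K →ₗ[ℂ] L))
      (shift ρ f s.vec) (s.ad s.vec) (s.ad_lie s.vec)
      (fun k => by simp [s.apply_ad, hf]) (fun k e => by simp [s.apply_ad, hρ, shift_apply]) p c
    -- With `b = d c`, the cycle condition `d a + θ(x) d c = 0` becomes `d (a + θ(x) c) = 0`, so `a
    -- + θ(x) c = d e`. Then `d(e - x ∧ c) = a + x ∧ b`.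
    rw [← hcomm, ← map_add] at hab
    obtain ⟨e, he⟩ := (h (p + 1) le_rfl).ge hab
    refine ⟨tensorMap E (j : K →ₗ[ℂ] L) (p + 2) e -
      (wedge (p + 1) s.vec).lTensor E (tensorMap E (j : K →ₗ[ℂ] L) (p + 1) c), ?_⟩
    rw [map_sub, boundarySucc_tensorMap, boundarySucc_wedge_vec_succ, he, map_add]
    abel

/-- If the complexes of `L` for all extensions of `f` are exact in degree `p`, then so is the
complex of the ideal. -/
theorem range_eq_ker_of_forall [CompleteSpace E] [FiniteDimensional ℂ K] (ρ : L →ₗ[ℂ] E →L[ℂ] E)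
    (hρ : ∀ (x y : L) (e : E), ρ ⁅x, y⁆ e = ρ y (ρ x e) - ρ x (ρ y e))
    (f : Module.Dual ℂ K) (hf : ∀ y k, f (s.ad y k) = 0) (p : ℕ)
    (h : ∀ c : ℂ, LinearMap.range (boundarySucc ρ (f ∘ₗ s.proj + c • s.coord) p) =
      LinearMap.ker (boundary ρ (f ∘ₗ s.proj + c • s.coord) p)) :
    LinearMap.range (boundarySucc (ρ ∘ₗ (j : K →ₗ[ℂ] L)) f p) =
      LinearMap.ker (boundary (ρ ∘ₗ (j : K →ₗ[ℂ] L)) f p) := by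
  have hfK (k l : K) : f ⁅k, l⁆ = 0 := by
    rw [← hf (j k) l]
    congr 1
    exact s.injective (by simp [s.apply_ad])
  have hρK (k l : K) (e : E) : (ρ ∘ₗ (j : K →ₗ[ℂ] L)) ⁅k, l⁆ e =
      (ρ ∘ₗ (j : K →ₗ[ℂ] L)) l ((ρ ∘ₗ (j : K →ₗ[ℂ] L)) k e) -
        (ρ ∘ₗ (j : K →ₗ[ℂ] L)) k ((ρ ∘ₗ (j : K →ₗ[ℂ] L)) l e) := by
    simp [hρ]
  have hext (c : ℂ) : (f ∘ₗ s.proj + c • s.coord) ∘ₗ (j : K →ₗ[ℂ] L) = f := by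
    ext k
    simp [s.proj_apply, s.coord_apply]
  set ρK := ρ ∘ₗ (j : K →ₗ[ℂ] L)
  have hcomm (p : ℕ) (u : E ⊗[ℂ] ⋀[ℂ]^(p + 1) K) :
      boundarySucc ρK f p (tensorAction (ρ s.vec : Module.End ℂ E) (s.ad s.vec) (p + 1) u) =
        tensorAction (ρ s.vec : Module.End ℂ E) (s.ad s.vec) p (boundarySucc ρK f p u) :=
    boundarySucc_tensorAction ρK f (ρ s.vec : Module.End ℂ E) (s.ad s.vec) (s.ad_lie s.vec)
      (hf s.vec) (fun k e => by simp [ρK, s.apply_ad, hρ]) p u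
  refine le_antisymm (range_le_ker ρK hρK f hfK p) ?_
  -- the cycles, in coordinates
  let Z : Submodule ℂ (Fin (Module.finrank ℂ (⋀[ℂ]^p K)) → E) :=
    (LinearMap.ker (boundary ρK f p)).map (chainCoords E K p).toLinearMap
  have hZ (u : E ⊗[ℂ] ⋀[ℂ]^p K) : chainCoords E K p u ∈ Z ↔ boundary ρK f p u = 0 := by
    simp [Z]
  have hZclosed : IsClosed (Z : Set (Fin (Module.finrank ℂ (⋀[ℂ]^p K)) → E)) := by
    cases p with
    | zero =>
      convert isClosed_univ
      refine Set.eq_univ_of_forall fun v => ?_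
      obtain ⟨u, rfl⟩ := (chainCoords E K 0).surjective v
      exact (hZ u).2 rfl
    | succ p =>
      convert isClosed_singleton.preimage (boundarySuccL ρK f p).continuous (t := {0})
      ext v
      obtain ⟨u, rfl⟩ := (chainCoords E K (p + 1)).surjective v
      rw [SetLike.mem_coe, hZ, Set.mem_preimage, boundarySuccL_apply, Set.mem_singleton_iff,
        LinearEquiv.map_eq_zero_iff]
      rfl
  -- The cycles form a Banach space, but the boundaries in it need not be closed; the cokernel of
  -- `a` below is `H_p(K)`, with `A` acting on it.
  have : CompleteSpace Z := hZclosed.completeSpace_coe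
  have hrange (v) : boundarySuccL ρK f p v ∈ Z := by
    obtain ⟨u, rfl⟩ := (chainCoords E K (p + 1)).surjective v
    rw [boundarySuccL_apply, hZ]
    exact range_le_ker ρK hρK f hfK p ⟨u, rfl⟩
  have hinv : ∀ v ∈ Z, tensorActionL (ρ s.vec) (s.ad s.vec) p v ∈ Z := fun v hv => by
    obtain ⟨u, rfl⟩ := (chainCoords E K p).surjective v
    rw [tensorActionL_apply, hZ]
    rw [hZ] at hv
    cases p with
    | zero => rfl
    | succ p =>
      refine (hcomm p u).trans ?_
      rw [show boundarySucc ρK f p u = 0 from hv, map_zero]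
  let a := (boundarySuccL ρK f p).codRestrict Z hrange
  let A : Z →L[ℂ] Z := ((tensorActionL (ρ s.vec) (s.ad s.vec) p).comp Z.subtypeL).codRestrict Z
    fun v => hinv v v.2
  have hsurj : Function.Surjective a := by
    refine surjective_of_forall_sub_smul_add a A (tensorActionL (ρ s.vec) (s.ad s.vec) (p + 1))
      (fun v => Subtype.ext ?_) fun c y => ?_
    · obtain ⟨u, rfl⟩ := (chainCoords E K (p + 1)).surjective v
      change tensorActionL (ρ s.vec) (s.ad s.vec) p (boundarySuccL ρK f p _) =
        boundarySuccL ρK f p _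
      rw [boundarySuccL_apply, tensorActionL_apply, tensorActionL_apply, boundarySuccL_apply,
        hcomm]
    · obtain ⟨y, hy⟩ := y
      obtain ⟨u, rfl⟩ := (chainCoords E K p).surjective y
      rw [hZ] at hy
      have hu : tensorMap E (j : K →ₗ[ℂ] L) p u ∈
          LinearMap.ker (boundary ρ (f ∘ₗ s.proj + c • s.coord) p) := by
        cases p with
        | zero => rfl
        | succ p =>
          refine (boundarySucc_tensorMap ρ _ j p u).trans ?_
          rw [hext, show boundarySucc (ρ ∘ₗ (j : K →ₗ[ℂ] L)) f p u = 0 from hy, map_zero]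
      -- A cycle `u` of `K` is a boundary `d(x + vec ∧ n)` in the complex of `L` for the extension
      -- with value `c` at `vec`. Comparing components gives `u = d x + (A - c) n` with `n` a cycle
      -- of `K`.
      obtain ⟨w, hw⟩ := (h c).ge hu
      obtain ⟨x, n, rfl⟩ := s.exists_tensorMap_add_wedge p w
      obtain ⟨hxn, hn⟩ := (s.boundarySucc_eq_tensorMap_iff ρ _ p x n u).1 hw
      rw [hext] at hxn hn
      refine ⟨⟨chainCoords E K p n, (hZ n).2 hn⟩, chainCoords E K (p + 1) x, Subtype.ext ?_⟩
      change tensorActionL (ρ s.vec) (s.ad s.vec) p (chainCoords E K p n) -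
        c • chainCoords E K p n + boundarySuccL ρK f p (chainCoords E K (p + 1) x) = _
      rw [tensorActionL_apply, boundarySuccL_apply, ← map_smul, ← map_sub, ← map_add,
        add_comm, ← tensorAction_sub_smul]
      refine congrArg (chainCoords E K p) (Eq.trans ?_ hxn)
      congr 4
      simp [s.proj_vec, s.coord_vec]
  intro u hu
  obtain ⟨v, hv⟩ := hsurj ⟨chainCoords E K p u, (hZ u).2 hu⟩
  obtain ⟨w, rfl⟩ := (chainCoords E K (p + 1)).surjective v
  refine ⟨w, (chainCoords E K p).injective ?_⟩
  rw [← boundarySuccL_apply]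
  exact congrArg Subtype.val hv

/-- The projection property for an ideal of codimension one. -/
theorem slodkowskiDelta_eq [CompleteSpace E] [FiniteDimensional ℂ K] (s : Splitting j)
    (ρ : L →ₗ[ℂ] E →L[ℂ] E)
    (hρ : ∀ (x y : L) (e : E), ρ ⁅x, y⁆ e = ρ y (ρ x e) - ρ x (ρ y e)) (k : ℕ) :
    slodkowskiDelta (ρ ∘ₗ (j : K →ₗ[ℂ] L)) k =
      (fun f : Module.Dual ℂ L => f ∘ₗ (j : K →ₗ[ℂ] L)) '' slodkowskiDelta ρ k := by
  ext f
  simp only [slodkowskiDelta, Set.mem_iUnion, Set.mem_image, exists_prop]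
  constructor
  · rintro ⟨p, hp, hf⟩
    have hinv (y : L) (k : K) : f (s.ad y k) = 0 :=
      apply_derivation_eq_zero (ρ ∘ₗ (j : K →ₗ[ℂ] L)) (fun k l e => by simp [hρ]) (ρ y) (s.ad y)
        (s.ad_lie y) (fun k e => by simp [s.apply_ad, hρ]) hf k
    -- Invariance of `f` under `ad y` makes `f ∘ proj` a character of `L`: brackets with an element
    -- of `K` are killed, and `[vec, vec] = 0`. All extensions `f ∘ proj + c • coord` are then
    -- candidates for the spectrum of `L`.
    have hproj (y z : L) : f (s.proj ⁅y, z⁆) = 0 := by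
      have h (y : L) (k : K) : f (s.proj ⁅y, j k⁆) = 0 := hinv y k
      rw [← s.decomp z, lie_add, map_add, map_add, h, zero_add, lie_smul, map_smul, map_smul,
        ← lie_skew, map_neg, map_neg, ← s.decomp y, lie_add, map_add, map_add, h, lie_smul,
        lie_self]
      simp
    by_contra! hcon
    refine hf.2 (s.range_eq_ker_of_forall ρ hρ f hinv p fun c => ?_)
    by_contra hne
    refine hcon (f ∘ₗ s.proj + c • s.coord) ⟨p, hp, fun y z => ?_, hne⟩ ?_
    · simp [hproj, s.coord_lie]
    · ext k
      simp [s.proj_apply, s.coord_apply]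
  · rintro ⟨f, ⟨p, hp, hf⟩, rfl⟩
    by_contra! hcon
    refine hf.2 (s.range_eq_ker ρ hρ f hf.1 p fun q hq => ?_)
    by_contra hne
    exact hcon q (hq.trans hp) ⟨fun k l => by simp [hf.1], hne⟩

end Splitting

end CodimOne

/-! ### Isomorphism invariance and induction along a chain of ideals -/

section Projection

variable {E : Type*} [NormedAddCommGroup E] [NormedSpace ℂ E]

theorem tensorMap_bijective {K L : Type*} [LieRing K] [LieAlgebra ℂ K] [LieRing L]
    [LieAlgebra ℂ L] (e : K ≃ₗ[ℂ] L) (p : ℕ) :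
    Function.Bijective (tensorMap E (e : K →ₗ[ℂ] L) p) := by
  refine Function.bijective_iff_has_inverse.2
    ⟨tensorMap E (e.symm : L →ₗ[ℂ] K) p, fun u => ?_, fun u => ?_⟩
  · rw [tensorMap, tensorMap, ← LinearMap.lTensor_comp_apply, ← exteriorPower.map_comp,
      e.symm_comp, exteriorPower.map_id, LinearMap.lTensor_id, LinearMap.id_apply]
  · rw [tensorMap, tensorMap, ← LinearMap.lTensor_comp_apply, ← exteriorPower.map_comp,
      e.comp_symm, exteriorPower.map_id, LinearMap.lTensor_id, LinearMap.id_apply]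

theorem mem_sigmaDegree_comp_iff {K L : Type*} [LieRing K] [LieAlgebra ℂ K] [LieRing L]
    [LieAlgebra ℂ L] (j : K →ₗ⁅ℂ⁆ L) (hj : Function.Bijective j) (ρ : L →ₗ[ℂ] E →L[ℂ] E)
    (p : ℕ) (f : Module.Dual ℂ L) :
    f ∘ₗ (j : K →ₗ[ℂ] L) ∈ sigmaDegree (ρ ∘ₗ (j : K →ₗ[ℂ] L)) p ↔ f ∈ sigmaDegree ρ p := by
  have hT (p : ℕ) : Function.Bijective (tensorMap E (j : K →ₗ[ℂ] L) p) :=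
    tensorMap_bijective (LinearEquiv.ofBijective (j : K →ₗ[ℂ] L) hj) p
  have hrange : LinearMap.range (boundarySucc ρ f p) =
      (LinearMap.range (boundarySucc (ρ ∘ₗ (j : K →ₗ[ℂ] L)) (f ∘ₗ (j : K →ₗ[ℂ] L)) p)).map
        (tensorMap E (j : K →ₗ[ℂ] L) p) := by
    ext u
    constructor
    · rintro ⟨v, rfl⟩
      obtain ⟨w, rfl⟩ := (hT (p + 1)).2 v
      exact ⟨_, ⟨w, rfl⟩, (boundarySucc_tensorMap ρ f j p w).symm⟩
    · rintro ⟨_, ⟨w, rfl⟩, rfl⟩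
      exact ⟨_, boundarySucc_tensorMap ρ f j p w⟩
  have hker : LinearMap.ker (boundary ρ f p) =
      (LinearMap.ker (boundary (ρ ∘ₗ (j : K →ₗ[ℂ] L)) (f ∘ₗ (j : K →ₗ[ℂ] L)) p)).map
        (tensorMap E (j : K →ₗ[ℂ] L) p) := by
    ext u
    obtain ⟨u, rfl⟩ := (hT p).2 u
    rw [← SetLike.mem_coe (p := Submodule.map _ _), Submodule.map_coe, (hT p).1.mem_set_image,
      SetLike.mem_coe, LinearMap.mem_ker, LinearMap.mem_ker]
    cases p with
    | zero => simp [boundary]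
    | succ p =>
      rw [show boundary ρ f (p + 1) _ = _ from boundarySucc_tensorMap ρ f j p u,
        map_eq_zero_iff _ (hT p).1]
      rfl
  refine and_congr ⟨fun h x y => ?_, fun h x y => ?_⟩ ?_
  · obtain ⟨x, rfl⟩ := hj.2 x
    obtain ⟨y, rfl⟩ := hj.2 y
    simpa using h x y
  · simp [h]
  · rw [hrange, hker, (Submodule.map_injective_of_injective (hT p).1).ne_iff]

theorem slodkowskiDelta_eq_of_bijective {K L : Type*} [LieRing K] [LieAlgebra ℂ K] [LieRing L]
    [LieAlgebra ℂ L] (j : K →ₗ⁅ℂ⁆ L) (hj : Function.Bijective j) (ρ : L →ₗ[ℂ] E →L[ℂ] E) (k : ℕ) :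
    slodkowskiDelta (ρ ∘ₗ (j : K →ₗ[ℂ] L)) k =
      (fun f : Module.Dual ℂ L => f ∘ₗ (j : K →ₗ[ℂ] L)) '' slodkowskiDelta ρ k := by
  have hsurj (f : Module.Dual ℂ K) : ∃ f' : Module.Dual ℂ L, f' ∘ₗ (j : K →ₗ[ℂ] L) = f :=
    ⟨f ∘ₗ (LinearEquiv.ofBijective (j : K →ₗ[ℂ] L) hj).symm, LinearMap.ext fun k =>
      congrArg f ((LinearEquiv.ofBijective (j : K →ₗ[ℂ] L) hj).symm_apply_apply k)⟩
  ext f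
  simp only [slodkowskiDelta, Set.mem_iUnion, Set.mem_image, exists_prop]
  constructor
  · rintro ⟨p, hp, hf⟩
    obtain ⟨f, rfl⟩ := hsurj f
    exact ⟨f, ⟨p, hp, (mem_sigmaDegree_comp_iff j hj ρ p f).1 hf⟩, rfl⟩
  · rintro ⟨f, ⟨p, hp, hf⟩, rfl⟩
    exact ⟨p, hp, (mem_sigmaDegree_comp_iff j hj ρ p f).2 hf⟩

/-- A proper ideal of a solvable Lie algebra lies in the kernel of a nonzero character. -/
theorem exists_character {L : Type*} [LieRing L] [LieAlgebra ℂ L] [LieAlgebra.IsSolvable L]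
    (I : LieIdeal ℂ L) (hI : I ≠ ⊤) : ∃ (g : Module.Dual ℂ L) (x : L), g x = 1 ∧
      (∀ y z : L, g ⁅y, z⁆ = 0) ∧ ∀ y ∈ I, g y = 0 := by
  have : Nontrivial (L ⧸ I) := Submodule.Quotient.nontrivial_iff.2 (by simpa using hI)
  have : LieAlgebra.IsSolvable (L ⧸ I) :=
    Function.Surjective.lieAlgebra_isSolvable
      (f := ({ toLinearMap := (LieSubmodule.Quotient.mk' I : L →ₗ[ℂ] L ⧸ I), map_lie' := rfl } :
        L →ₗ⁅ℂ⁆ L ⧸ I)) (LieSubmodule.Quotient.surjective_mk' I)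
  -- A nonzero solvable Lie algebra is not perfect, so `L ⧸ I` has a nonzero linear form vanishing
  -- on its brackets.
  have hlt := LieAlgebra.derivedSeries_lt_top_of_solvable ℂ (L ⧸ I)
  obtain ⟨φ, hφ, hker⟩ := Submodule.exists_le_ker_of_lt_top
    (LieAlgebra.derivedSeries ℂ (L ⧸ I) 1).toSubmodule (by
      rw [lt_top_iff_ne_top] at hlt ⊢
      simpa using hlt)
  obtain ⟨q, hq⟩ := DFunLike.ne_iff.1 hφ
  obtain ⟨x, rfl⟩ := LieSubmodule.Quotient.surjective_mk' I q
  let g : Module.Dual ℂ L := φ ∘ₗ (LieSubmodule.Quotient.mk' I : L →ₗ[ℂ] L ⧸ I)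
  have hx : g x ≠ 0 := hq
  refine ⟨g, (g x)⁻¹ • x, by rw [map_smul, smul_eq_mul, inv_mul_cancel₀ hx], fun y z => ?_,
    fun y hy => ?_⟩
  · refine hker ?_
    change ⁅(LieSubmodule.Quotient.mk y : L ⧸ I), (LieSubmodule.Quotient.mk z : L ⧸ I)⁆ ∈ _
    exact LieSubmodule.lie_mem_lie (LieSubmodule.mem_top _) (LieSubmodule.mem_top _)
  · change φ (LieSubmodule.Quotient.mk y) = 0
    rw [(LieSubmodule.Quotient.mk_eq_zero' (N := I)).2 hy, map_zero]

/-- The splitting of a Lie algebra given by a character. -/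
def Splitting.ofCharacter {L : Type*} [LieRing L] [LieAlgebra ℂ L] (g : Module.Dual ℂ L) (x : L)
    (hx : g x = 1) (hg : ∀ y z : L, g ⁅y, z⁆ = 0) (J : LieIdeal ℂ L) (hJ : ∀ y, y ∈ J ↔ g y = 0) :
    Splitting J.incl where
  proj := LinearMap.codRestrict J.toSubmodule (LinearMap.id - g.smulRight x) fun y =>
    (hJ _).2 (by simp [hx])
  coord := g
  vec := x
  proj_apply k := Subtype.ext (by
    change (k : L) - g k • x = k
    rw [(hJ _).1 k.2, zero_smul, sub_zero])
  coord_vec := hx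
  decomp y := by
    change y - g y • x + g y • x = y
    exact sub_add_cancel y _
  coord_lie := hg

/-- An ideal is treated as an injective homomorphism `j` with ideal range, so that `K` stays fixed
in the induction while `L` is replaced by the smaller ideal `J` through which `j` factors. -/
theorem slodkowskiDelta_eq_of_injective [CompleteSpace E] (n : ℕ) {K : Type*} [LieRing K]
    [LieAlgebra ℂ K] [FiniteDimensional ℂ K] {L : Type*} [LieRing L] [LieAlgebra ℂ L]
    [FiniteDimensional ℂ L] [LieAlgebra.IsSolvable L] (hn : Module.finrank ℂ L = n)
    (j : K →ₗ⁅ℂ⁆ L) (hj : Function.Injective j)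
    (hideal : ∀ (y : L) (k : K), ∃ l, j l = ⁅y, j k⁆) (ρ : L →ₗ[ℂ] E →L[ℂ] E)
    (hρ : ∀ (x y : L) (e : E), ρ ⁅x, y⁆ e = ρ y (ρ x e) - ρ x (ρ y e)) (k : ℕ) :
    slodkowskiDelta (ρ ∘ₗ (j : K →ₗ[ℂ] L)) k =
      (fun f : Module.Dual ℂ L => f ∘ₗ (j : K →ₗ[ℂ] L)) '' slodkowskiDelta ρ k := by
  induction n using Nat.strong_induction_on generalizing L with
  | _ n ih =>
    by_cases hsurj : Function.Surjective j
    · exact slodkowskiDelta_eq_of_bijective j ⟨hj, hsurj⟩ ρ k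
    let I : LieIdeal ℂ L :=
      { LinearMap.range (j : K →ₗ[ℂ] L) with
        lie_mem := by
          rintro y _ ⟨k, rfl⟩
          obtain ⟨l, hl⟩ := hideal y k
          exact ⟨l, hl⟩ }
    have hI : I ≠ ⊤ := fun h => hsurj fun y => (h ▸ LieSubmodule.mem_top y : y ∈ I)
    obtain ⟨g, x, hx, hg, hgI⟩ := exists_character I hI
    let J : LieIdeal ℂ L :=
      { LinearMap.ker g with lie_mem := fun {y z} _ => hg y z }
    have hJ (y : L) : y ∈ J ↔ g y = 0 := Iff.rfl
    let j' : K →ₗ⁅ℂ⁆ J :=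
      { toFun := fun k => ⟨j k, hgI _ ⟨k, rfl⟩⟩
        map_add' := fun a b => Subtype.ext (map_add j a b)
        map_smul' := fun c a => Subtype.ext (map_smul j c a)
        map_lie' := fun {a b} => Subtype.ext (LieHom.map_lie j a b) }
    have hlt : Module.finrank ℂ J < n := hn ▸ Submodule.finrank_lt (s := J.toSubmodule) (by
      intro h
      have : x ∈ J.toSubmodule := h ▸ Submodule.mem_top
      exact one_ne_zero (hx.symm.trans this))
    have h1 := ih _ hlt rfl j' (fun a b hab => hj (congrArg Subtype.val hab))
      (fun y k => (hideal y k).imp fun l hl => Subtype.ext hl) (ρ ∘ₗ (J.incl : J →ₗ[ℂ] L))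
      (fun y z e => hρ y z e)
    -- Restriction from `L` to `K` is restriction to the codimension-one ideal `J` followed by
    -- restriction from `J` to `K`.
    have h2 := (Splitting.ofCharacter g x hx hg J hJ).slodkowskiDelta_eq ρ hρ k
    rw [h2, Set.image_image] at h1
    exact h1

end Projection

end SolvableSpectrum

theorem theorem4p7 {E : Type*} [NormedAddCommGroup E] [NormedSpace ℂ E] [CompleteSpace E]
    {L : Type*} [LieRing L] [LieAlgebra ℂ L] [FiniteDimensional ℂ L] [LieAlgebra.IsSolvable L]
    (ρ : L →ₗ[ℂ] E →L[ℂ] E)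
    (hρ : ∀ (x y : L) (e : E), ρ ⁅x, y⁆ e = ρ y (ρ x e) - ρ x (ρ y e))
    (I : LieIdeal ℂ L) (k : ℕ) :
    SolvableSpectrum.slodkowskiDelta (ρ ∘ₗ (I.incl : I →ₗ[ℂ] L)) k =
      (fun f : Module.Dual ℂ L => f ∘ₗ (I.incl : I →ₗ[ℂ] L)) ''
        SolvableSpectrum.slodkowskiDelta ρ k :=
  SolvableSpectrum.slodkowskiDelta_eq_of_injective _ rfl I.incl Subtype.val_injective
    (fun y k => ⟨⟨⁅y, k⁆, lie_mem_right ℂ L I y k k.2⟩, rfl⟩) ρ hρ k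

end
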